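/- Let $\mathbb K$ be an algebraically closed field of characteristic $2$ and $N\ge 2$. Let $\mathcal F$ be the tensor product of the algebra of truncated polynomials in even indeterminates $q_1,\dots,q_N$ ($q_i^2=0$) and the Grassmann algebra in odd indeterminates $\pi_1,\dots,\pi_N$. The Buttin superalgebra $\mathfrak b(N|N)$ is $\mathcal F$, with parity opposite to the parity of functions, with bracket $\{f,g\}=\sum_i\left(\frac{\partial f}{\partial q_i}\frac{\partial g}{\partial \pi_i}+\frac{\partial f}{\partial \pi_i}\frac{\partial g}{\partial q_i}\right)$, squaring $f\mapsto\sum_i \frac{\partial f}{\partial q_i}\frac{\partial f}{\partial \pi_i}$ of odd elements, and the non-degenerate invariant symmetric bilinear form (NIS) $B(f,g)=\int fg$, the coefficient of the product $\bar X$ of all indeterminates in $fg$. Let $\mathfrak{le}(N|N)=\mathfrak b(N|N)/\mathbb K\cdot 1$, and let $\mathfrak a=\mathfrak{le}^{(1)}(N|N)$ be its derived algebra (spanned by brackets and by squares of odd elements), with the form $B$ induced by $\int fg$. Put $S(q_i)=\pi_i$, $S(\pi_i)=q_i$, and define operators on $\mathfrak a$ as follows. For each indeterminate $b$, $D_b^{(0)}$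 sends $S(b)x$ to $bx$ for each monomial $x$ in the indeterminates other than $b$ and $S(b)$, and all other monomials to $0$. $D_0^{(0)}$ is the identity on monomials of even degree in the $\pi_i$ and zero on the others. $D^{(2N-2)}$ sends $S(x)$ to $\partial\bar X/\partial x$ for each indeterminate $x$, and all monomials of degree other than $1$ to $0$. A double extension of $(\mathfrak a,B)$ by a homogeneous derivation $D$ preserving $B$ is $\mathbb K c\oplus\mathfrak a\oplus\mathbb K D$ with $c$ central, of parity $p(c)=p(B)+p(D)$, with $[x,y]=[x,y]_{\mathfrak a}+B(Dx,y)c$ and $[D,x]=Dx$ for $x,y\in\mathfrak a$, and with the NIS extending $B$ with $B(c,D)=1$, $B(c,c)=B(c,\mathfrak a)=B(D,\mathfrak a)=0$ (and $B(D,D)=0$ unless both $B$ and $D$ are even). If $c$ is odd, then: for $D$ even, the squaring is $x+rc\mapsto x^2$; for $D$ odd, an even $A\in\mathfrak a$ with $D^2=\mathrm{ad}_A$ and $D(A)=0$ is needed, and the squaring is $rc+x+tD\mapsto x^2+tD(x)+t^2A$. (If $c$ is even, one needs in addition a quadratic form $q$ on the odd part of $\mathfrak a$ with polar form $B(Dx,y)$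 and, if $D$ is odd, a scalar $m$; then $q(x)c$, resp. $(q(x)+t^2m)c$, is added to the square.) As in $\mathfrak b(N|N)$, only double extensions with odd center $c$ are considered. Then $\mathfrak a$ is a Lie superalgebra, $B$ is a NIS on $\mathfrak a$ of parity $N\bmod 2$, and $D_b^{(0)}$, $D_0^{(0)}$, $D^{(2N-2)}$ are outer derivations of $\mathfrak a$ of parity $1$, $0$ and $N+1 \bmod 2$, respectively. A derivation that defines a double extension with odd center is odd if $N$ is even, and even if $N$ is odd. Moreover: 1. Let $N=2n$, $n\ge1$. Each $D_b^{(0)}$ defines a double extension with odd center, exactly with $A=0$; it is a Lie superalgebra with an even NIS, denoted by $\tilde{\mathfrak b}(2n|2n)$. $D_0^{(0)}$ defines none. $D^{(4n-2)}$ defines one, exactly with $A=0$, and it is isomorphic, as a Lie superalgebra with NIS, to $\mathfrak b(2n|2n)$. 2. Let $N=2n+1$, $n\ge1$. Neither $D_0^{(0)}$ nor any $D_b^{(0)}$ defines a double extension with odd center. $D^{(4n)}$ defines exactly one (no $A$ is needed, i.e. $A=0$), and it is isomorphic, as a Lie superalgebra with NIS, to $\mathfrak b(2n+1|2n+1)$.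 -/

import Mathlib

open scoped BigOperators

namespace Buttin

section General

variable {K : Type*} [Field K] {V : Type*} [AddCommGroup V] [Module K V]

/-! ## Lie superalgebras in characteristic 2 -/

/-- The data of a Lie superalgebra in characteristic `2`: a `ℤ/2`-grading, a bracket and a
squaring of odd elements (the values of `sq` outside `part 1` carry no meaning). The laws
are collected in `IsLieSuperalgebra`. -/
structure SuperData (K : Type*) [Field K] (V : Type*) [AddCommGroup V] [Module K V] where
  part : ZMod 2 → Submodule K V
  bracket : V → V → V
  sq : V → V

/-- The laws of a Lie superalgebra in characteristic `2`. The Jacobi identity for three odd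
elements is the polarization of `sq_bracket`, so it may be listed with the others; signs
are immaterial, since `1 = -1`. -/
structure IsLieSuperalgebra (g : SuperData K V) : Prop where
  isCompl : IsCompl (g.part 0) (g.part 1)
  add_bracket : ∀ x y z, g.bracket (x + y) z = g.bracket x z + g.bracket y z
  smul_bracket : ∀ (r : K) x y, g.bracket (r • x) y = r • g.bracket x y
  bracket_add : ∀ x y z, g.bracket x (y + z) = g.bracket x y + g.bracket x z
  bracket_smul : ∀ (r : K) x y, g.bracket x (r • y) = r • g.bracket x y
  bracket_mem : ∀ i j, ∀ x ∈ g.part i, ∀ y ∈ g.part j, g.bracket x y ∈ g.part (i + j)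
  even_self : ∀ x ∈ g.part 0, g.bracket x x = 0
  antisymm : ∀ x y, g.bracket x y = -g.bracket y x
  jacobi : ∀ x y z,
    g.bracket x (g.bracket y z) = g.bracket (g.bracket x y) z + g.bracket y (g.bracket x z)
  sq_mem : ∀ f ∈ g.part 1, g.sq f ∈ g.part 0
  sq_smul : ∀ (r : K), ∀ f ∈ g.part 1, g.sq (r • f) = r ^ 2 • g.sq f
  sq_add : ∀ f ∈ g.part 1, ∀ h ∈ g.part 1, g.sq (f + h) = g.sq f + g.sq h + g.bracket f h
  sq_bracket : ∀ f ∈ g.part 1, ∀ x, g.bracket (g.sq f) x = g.bracket f (g.bracket f x)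

/-- `B` is a NIS (non-degenerate invariant symmetric bilinear form) on `g`, homogeneous of
parity `p`; in characteristic `2`, symmetry includes `B f f = 0` for odd `f`. -/
structure IsNIS (g : SuperData K V) (B : V → V → K) (p : ZMod 2) : Prop where
  add_left : ∀ x y z, B (x + y) z = B x z + B y z
  smul_left : ∀ (r : K) x y, B (r • x) y = r * B x y
  symm : ∀ x y, B x y = B y x
  odd_self : ∀ f ∈ g.part 1, B f f = 0
  invariant : ∀ x y z, B (g.bracket x y) z = B x (g.bracket y z)
  nondegenerate : ∀ x, (∀ y, B x y = 0) → x = 0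
  homogeneous : ∀ i j, i + j ≠ p → ∀ x ∈ g.part i, ∀ y ∈ g.part j, B x y = 0

/-- `D` is a derivation of `g`, homogeneous of parity `p`. -/
structure IsDerivation (g : SuperData K V) (D : V →ₗ[K] V) (p : ZMod 2) : Prop where
  map_part : ∀ i, ∀ x ∈ g.part i, D x ∈ g.part (i + p)
  map_bracket : ∀ x y, D (g.bracket x y) = g.bracket (D x) y + g.bracket x (D y)
  map_sq : ∀ f ∈ g.part 1, D (g.sq f) = g.bracket (D f) f

/-- A homogeneous derivation of parity `p` that is not inner. -/
def IsOuterDerivation (g : SuperData K V) (D : V →ₗ[K] V) (p : ZMod 2) : Prop :=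
  IsDerivation g D p ∧ ¬ ∃ y, ∀ x, D x = g.bracket y x

/-- `D` preserves the form `B`. -/
def Preserves (g : SuperData K V) (B : V → V → K) (D : V →ₗ[K] V) : Prop :=
  (∀ x y, B (D x) y + B x (D y) = 0) ∧ ∀ f ∈ g.part 1, B (D f) f = 0

/-- The space of the derived algebra, spanned by the brackets and the squares of odd
elements. -/
def derivedSubmodule (g : SuperData K V) : Submodule K V :=
  Submodule.span K ({z | ∃ x y, z = g.bracket x y} ∪ {z | ∃ f ∈ g.part 1, z = g.sq f})

open Classical in
/-- The derived algebra, with the structure induced from `g`. -/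
noncomputable def derived (g : SuperData K V) : SuperData K (derivedSubmodule g) where
  part i := (g.part i).comap (derivedSubmodule g).subtype
  bracket x y := ⟨g.bracket x y, Submodule.subset_span (Or.inl ⟨x, y, rfl⟩)⟩
  sq x := if h : (x : V) ∈ g.part 1 then
    ⟨g.sq x, Submodule.subset_span (Or.inr ⟨x, h, rfl⟩)⟩ else 0

/-! ## Double extensions -/

/-- What a double extension of `(a, B)` by a derivation `D` depends on besides `D`: the parity
of `D`, the quadratic form `q` on the odd part of `a`, the even element `A`, the scalar `m`,
and the value `e` of the extended form on the pair `(D, D)`. -/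
structure ExtensionDatum (K : Type*) (V : Type*) where
  parity : ZMod 2
  q : V → K
  A : V
  m : K
  e : K

/-- `D` and `δ` satisfy the conditions under which they define a double extension of `(a, B)`,
where `B` has parity `p`. The new central element has parity `p + δ.parity`. What plays no
role for the given parities is `0`: `q` is needed only if the centre is even, `A` only if `D`
is odd, `m` only if both `B` and `D` are odd, `e` only if both are even. -/
structure IsExtensionDatum (a : SuperData K V) (B : V → V → K) (p : ZMod 2) (D : V →ₗ[K] V)
    (δ : ExtensionDatum K V) : Prop where
  derivation : IsDerivation a D δ.parity
  preserves : Preserves a B D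
  q_smul : p + δ.parity = 0 → ∀ (r : K), ∀ f ∈ a.part 1, δ.q (r • f) = r ^ 2 * δ.q f
  q_polar : p + δ.parity = 0 →
    ∀ f ∈ a.part 1, ∀ h ∈ a.part 1, δ.q (f + h) - δ.q f - δ.q h = B (D f) h
  q_eq_zero : p + δ.parity ≠ 0 → δ.q = 0
  A_mem : δ.A ∈ a.part 0
  D_sq : δ.parity = 1 → ∀ x, D (D x) = a.bracket δ.A x
  D_A : δ.parity = 1 → D δ.A = 0
  A_eq_zero : δ.parity ≠ 1 → δ.A = 0
  m_eq_zero : ¬ (p = 1 ∧ δ.parity = 1) → δ.m = 0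
  e_eq_zero : ¬ (p = 0 ∧ δ.parity = 0) → δ.e = 0

/-- The double extension `K c ⊕ a ⊕ K D`; the triple `(r, x, t)` stands for `r c + x + t D`.
The element `D` has the parity of the derivation `D`, and `c` has parity `p + δ.parity`. -/
def doubleExtension (a : SuperData K V) (B : V → V → K) (p : ZMod 2) (D : V →ₗ[K] V)
    (δ : ExtensionDatum K V) : SuperData K (K × V × K) where
  part i := Submodule.prod (if i = p + δ.parity then ⊤ else ⊥)
    (Submodule.prod (a.part i) (if i = δ.parity then ⊤ else ⊥))
  bracket x y :=
    (B (D x.2.1) y.2.1, a.bracket x.2.1 y.2.1 + x.2.2 • D y.2.1 - y.2.2 • D x.2.1, 0)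
  sq x := (δ.q x.2.1 + x.2.2 ^ 2 * δ.m, a.sq x.2.1 + x.2.2 • D x.2.1 + x.2.2 ^ 2 • δ.A, 0)

/-- The form on the double extension: it extends `B`, pairs `c` with `D` to `1`, makes `c` and
`D` orthogonal to `a`, and takes the values `0` at `(c, c)` and `δ.e` at `(D, D)`. -/
def extensionForm (B : V → V → K) (δ : ExtensionDatum K V) (x y : K × V × K) : K :=
  B x.2.1 y.2.1 + x.1 * y.2.2 + x.2.2 * y.1 + x.2.2 * y.2.2 * δ.e

/-- The datum `δ` makes `D` define a double extension of `(a, B)` whose central element `c` is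
odd. -/
def IsOddCentredDatum (a : SuperData K V) (B : V → V → K) (p : ZMod 2) (D : V →ₗ[K] V)
    (δ : ExtensionDatum K V) : Prop :=
  IsExtensionDatum a B p D δ ∧ ((1, 0, 0) : K × V × K) ∈ (doubleExtension a B p D δ).part 1

/-- The two superalgebras with forms are isomorphic: there is an even linear bijection that
respects brackets, squarings and forms. -/
def NisIsomorphic {W : Type*} [AddCommGroup W] [Module K W] (g : SuperData K V)
    (B : V → V → K) (h : SuperData K W) (C : W → W → K) : Prop :=
  ∃ φ : V ≃ₗ[K] W, (∀ i x, x ∈ g.part i ↔ φ x ∈ h.part i) ∧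
    (∀ x y, φ (g.bracket x y) = h.bracket (φ x) (φ y)) ∧
    (∀ f ∈ g.part 1, φ (g.sq f) = h.sq (φ f)) ∧
    ∀ x y, C (φ x) (φ y) = B x y

end General

/-! ## The Buttin superalgebra -/

/-- The indeterminates: `Sum.inl i` is the even `q i`, and `Sum.inr i` is the odd `π i`. The
involution exchanging `q i` and `π i` is `Sum.swap`. -/
abbrev Var (N : ℕ) := Fin N ⊕ Fin N

/-- The tensor product of the algebra `K[q] / (q i ^ 2)` of truncated polynomials and the
Grassmann algebra of the `π i`: an element is given by its coefficients at the square-free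
monomials, and a monomial by the set of its indeterminates. As `K` has characteristic `2`,
there are no signs, and the product is the commutative one with `x ^ 2 = 0` for each
indeterminate `x`. -/
abbrev Fn (K : Type*) (N : ℕ) := Finset (Var N) → K

section Concrete

variable (K : Type*) [Field K] (N : ℕ)

/-- The monomial with set of indeterminates `S`. -/
def mono (S : Finset (Var N)) : Fn K N := Pi.single S 1

variable {K N}

/-- The product of functions. -/
def mul (f g : Fn K N) : Fn K N := fun S => ∑ T ∈ S.powerset, f T * g (S \ T)

/-- The partial derivative with respect to the indeterminate `v`. -/
def pd (v : Var N) (f : Fn K N) : Fn K N := fun S => if v ∈ S then 0 else f (insert v S)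

/-- The Berezin integral: the coefficient of the product of all indeterminates. -/
def berezin (f : Fn K N) : K := f Finset.univ

/-- The degree of a monomial in the odd indeterminates. -/
def degPi (S : Finset (Var N)) : ℕ := (S.filter (fun v => v.isRight = true)).card

variable (K N)

/-- The Buttin superalgebra `𝔟(N|N)` with the antibracket; the parity in the superalgebra is
opposite to the parity as a function. The square of an odd element has the antibracket as its
polarization. -/
def buttin : SuperData K (Fn K N) where
  part i :=
    { carrier := {f | ∀ S, f S ≠ 0 → (degPi S : ZMod 2) + 1 = i}
      add_mem' := by
        intro f g hf hg S hS
        by_cases h : f S = 0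
        · exact hg S (fun h' => hS (by simp [h, h']))
        · exact hf S h
      zero_mem' := by intro S hS; simp at hS
      smul_mem' := by
        intro r f hf S hS
        exact hf S (fun h => hS (by simp [h])) }
  bracket f g := ∑ i : Fin N, (mul (pd (Sum.inl i) f) (pd (Sum.inr i) g) +
    mul (pd (Sum.inr i) f) (pd (Sum.inl i) g))
  sq f := ∑ i : Fin N, mul (pd (Sum.inl i) f) (pd (Sum.inr i) f)

/-- The form on `𝔟(N|N)` given by the Berezin integral of the product. -/
def buttinForm (f g : Fn K N) : K := berezin (mul f g)

/-- The subspace of constants. -/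
def constants : Submodule K (Fn K N) := Submodule.span K {mono K N ∅}

/-- The space of functions modulo constants. -/
abbrev LeSpace := Fn K N ⧸ constants K N

/-- The constant-free representative of a function modulo constants. -/
def rep : LeSpace K N →ₗ[K] Fn K N :=
  (constants K N).liftQ
    { toFun := fun f S => if S = ∅ then 0 else f S
      map_add' := by intro f g; funext S; by_cases h : S = ∅ <;> simp [h]
      map_smul' := by intro r f; funext S; by_cases h : S = ∅ <;> simp [h] }
    (by
      rw [constants, Submodule.span_singleton_le_iff_mem, LinearMap.mem_ker]
      funext S
      by_cases h : S = ∅ <;> simp [h, mono])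

/-- `𝔩𝔢(N|N)`, the quotient of `𝔟(N|N)` by the constants. Bracket and squaring of functions
do not change if constants are added to the arguments, so they may be computed on the
constant-free representatives. -/
def le : SuperData K (LeSpace K N) where
  part i := ((buttin K N).part i).map (constants K N).mkQ
  bracket x y := (constants K N).mkQ ((buttin K N).bracket (rep K N x) (rep K N y))
  sq x := (constants K N).mkQ ((buttin K N).sq (rep K N x))

/-- The space of `𝔩𝔢⁽¹⁾(N|N)`. -/
abbrev LeOneSpace := derivedSubmodule (le K N)

/-- `𝔩𝔢⁽¹⁾(N|N)`, the derived algebra of `𝔩𝔢(N|N)`. -/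
noncomputable def leOne : SuperData K (LeOneSpace K N) := derived (le K N)

/-- The form on `𝔩𝔢⁽¹⁾(N|N)` induced by the Berezin integral of the product. -/
def leOneForm (x y : LeOneSpace K N) : K :=
  buttinForm K N (rep K N (x : LeSpace K N)) (rep K N (y : LeSpace K N))

/-! ### Membership in `𝔩𝔢⁽¹⁾(N|N)` -/

variable {K N}

lemma pd_mono (v : Var N) (S : Finset (Var N)) :
    pd v (mono K N S) = if v ∈ S then mono K N (S.erase v) else 0 := by
  funext T
  by_cases hS : v ∈ S
  · simp only [pd, mono, hS, if_true, Pi.single_apply]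
    by_cases hT : v ∈ T
    · have : T ≠ S.erase v := by rintro rfl; simp at hT
      simp [hT, this]
    · have : insert v T = S ↔ T = S.erase v := by
        constructor
        · rintro rfl; simp [hT]
        · rintro rfl; simp [hS]
      simp [hT, this]
  · simp only [pd, mono, hS, if_false, Pi.single_apply]
    have : insert v T ≠ S := by rintro rfl; simp at hS
    simp [this]

lemma zero_mul' (g : Fn K N) : mul 0 g = 0 := by
  funext S; simp [mul]

lemma mono_empty_mul (g : Fn K N) : mul (mono K N ∅) g = g := by
  funext S
  simp only [mul, mono, Pi.single_apply]
  rw [Finset.sum_eq_single ∅]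
  · simp
  · intro T _ hT; simp [hT]
  · intro h; simp at h

lemma rep_mkQ_mono {S : Finset (Var N)} (hS : S ≠ ∅) :
    rep K N ((constants K N).mkQ (mono K N S)) = mono K N S := by
  funext T
  simp only [rep, Submodule.mkQ_apply, Submodule.liftQ_apply, LinearMap.coe_mk, AddHom.coe_mk,
    mono, Pi.single_apply]
  by_cases hT : T = ∅
  · subst hT; simp [Ne.symm hS]
  · simp [hT]

lemma buttin_bracket_mono (v : Var N) {S : Finset (Var N)} (hS : v ∉ S) :
    (buttin K N).bracket (mono K N {v.swap}) (mono K N (insert v S)) = mono K N S := by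
  simp only [buttin, pd_mono]
  cases v with
  | inl j =>
    rw [Finset.sum_eq_single j]
    · simp [zero_mul', mono_empty_mul, hS]
    · intro i _ hi; simp [zero_mul', hi]
    · simp
  | inr j =>
    rw [Finset.sum_eq_single j]
    · simp [zero_mul', mono_empty_mul, hS]
    · intro i _ hi; simp [zero_mul', hi]
    · simp

/-- A function without the monomial of highest degree represents an element of `𝔩𝔢⁽¹⁾(N|N)`. -/
lemma mkQ_mem_leOne (f : Fn K N) (hf : f Finset.univ = 0) :
    (constants K N).mkQ f ∈ LeOneSpace K N := by
  have hsum : f = ∑ S, f S • mono K N S := by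
    funext T
    simp [mono, Pi.single_apply]
  rw [hsum, map_sum]
  refine Submodule.sum_mem _ fun S _ => ?_
  rw [map_smul]
  by_cases hS : S = Finset.univ
  · subst hS; simp [hf]
  refine Submodule.smul_mem _ _ ?_
  obtain ⟨v, hv⟩ : ∃ v, v ∉ S := by
    by_contra! h
    exact hS (Finset.eq_univ_iff_forall.2 h)
  refine Submodule.subset_span (Or.inl ⟨(constants K N).mkQ (mono K N {v.swap}),
    (constants K N).mkQ (mono K N (insert v S)), ?_⟩)
  simp only [le]
  rw [rep_mkQ_mono (by simp), rep_mkQ_mono (by simp), buttin_bracket_mono v hv]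

/-! ### The derivations -/

variable (K N)

/-- The operator `X ⊗ Y^` on functions for monomials `X`, `Y`: it sends `Y` to `X` and all other
monomials to `0`. -/
def unitOp (S T : Finset (Var N)) : Fn K N →ₗ[K] Fn K N :=
  LinearMap.smulRight (LinearMap.proj T) (mono K N S)

/-- The sum over all pairs `(X, Y)` of monomials in `P` of the operators `X ⊗ Y^`. -/
def sumOp (P : Finset (Finset (Var N) × Finset (Var N))) : Fn K N →ₗ[K] Fn K N :=
  ∑ s ∈ P, unitOp K N s.1 s.2

variable {K N} in
lemma sumOp_univ (P : Finset (Finset (Var N) × Finset (Var N)))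
    (hP : ∀ s ∈ P, s.1 ≠ Finset.univ) (f : Fn K N) : sumOp K N P f Finset.univ = 0 := by
  simp only [sumOp, LinearMap.sum_apply, Finset.sum_apply]
  refine Finset.sum_eq_zero fun s hs => ?_
  simp [unitOp, mono, (hP s hs).symm]

/-- The operator on `𝔩𝔢⁽¹⁾(N|N)` induced by `sumOp`, when no pair in `P` has the product of all
indeterminates as its first member. -/
def leOp (P : Finset (Finset (Var N) × Finset (Var N))) (hP : ∀ s ∈ P, s.1 ≠ Finset.univ) :
    LeOneSpace K N →ₗ[K] LeOneSpace K N :=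
  LinearMap.codRestrict (LeOneSpace K N)
    ((constants K N).mkQ ∘ₗ sumOp K N P ∘ₗ rep K N ∘ₗ (LeOneSpace K N).subtype)
    (fun x => mkQ_mem_leOne _ (sumOp_univ P hP (rep K N (x : LeSpace K N))))

/-- The derivation `D_b` of degree `0`: it sends `S(b) x` to `b x` for each monomial `x` in the
indeterminates other than `b` and `S(b)`, and all other monomials to `0`. -/
def derivB (b : Var N) : LeOneSpace K N →ₗ[K] LeOneSpace K N :=
  leOp K N ((Finset.univ \ {b, b.swap}).powerset.image fun x => (insert b x, insert b.swap x))
    (by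
      intro s hs hu
      simp only [Finset.mem_image, Finset.mem_powerset] at hs
      obtain ⟨x, hx, rfl⟩ := hs
      have hu' : insert b x = Finset.univ := hu
      have h1 : b.swap ∈ insert b x := by rw [hu']; simp
      rcases Finset.mem_insert.1 h1 with h | h
      · cases b <;> simp at h
      · have := hx h
        simp at this)

/-- The derivation `D_0` of degree `0`: it is the identity on the monomials of even degree in
the odd indeterminates, and zero on the others. -/
def derivZero : LeOneSpace K N →ₗ[K] LeOneSpace K N :=
  leOp K N ((Finset.univ.filter fun S : Finset (Var N) =>
      S ≠ ∅ ∧ S ≠ Finset.univ ∧ Even (degPi S)).image fun S => (S, S))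
    (by
      intro s hs
      simp only [Finset.mem_image, Finset.mem_filter] at hs
      obtain ⟨S, hS, rfl⟩ := hs
      exact hS.2.2.1)

/-- The derivation of degree `2N - 2`: it sends the indeterminate `S(x)` to the derivative by `x`
of the product of all indeterminates, for each indeterminate `x`, and all monomials of
degree other than `1` to `0`. -/
def derivTop : LeOneSpace K N →ₗ[K] LeOneSpace K N :=
  leOp K N (Finset.univ.image fun x : Var N => (Finset.univ.erase x, {x.swap}))
    (by
      intro s hs hu
      simp only [Finset.mem_image] at hs
      obtain ⟨x, -, rfl⟩ := hs
      have hu' : Finset.univ.erase x = Finset.univ := hu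
      have : x ∈ Finset.univ.erase x := by rw [hu']; simp
      simp at this)

/-- The datum of a double extension by an odd derivation with `A = 0` (and nothing else). -/
def oddDatum : ExtensionDatum K (LeOneSpace K N) := ⟨1, 0, 0, 0, 0⟩

/-- The datum of a double extension by an even derivation with no additional ingredients. -/
def evenDatum : ExtensionDatum K (LeOneSpace K N) := ⟨0, 0, 0, 0, 0⟩

/-- For even `N`, the superalgebra denoted `𝔟` with a tilde: the double extension of
`𝔩𝔢⁽¹⁾(N|N)` by the odd derivation `D_b` with `A = 0`. -/
noncomputable def tildeButtin (b : Var N) : SuperData K (K × LeOneSpace K N × K) :=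
  doubleExtension (leOne K N) (leOneForm K N) (N : ZMod 2) (derivB K N b) (oddDatum K N)

end Concrete

end Buttin

namespace Buttin

/-! ### The ring of functions and its partial derivatives -/

section Algebra

variable {K : Type*} [Field K] {N : ℕ}

/-! In characteristic 2 all signs disappear. Functions form a commutative ring with commuting,
square-zero derivations ∂_v, and the antibracket is the sum of ∂_v f · ∂_{S(v)} g over all 2N
indeterminates (`bracket_eq_sum`). The Lie laws follow from Leibniz and cancellation of equal terms
in pairs (`bracket_jacobi`, `bracket_bracket_self`), and invariance of the form is integration by
parts (`buttinForm_invariant`).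

No bracket has a top coefficient, and for N ≥ 2 no square has one either (`bracket_univ`,
`sq_univ`). Hence the derived algebra consists exactly of the functions with neither constant nor
top term, taken as representatives modulo constants. The deleted coefficients are dual to each
other, so the form stays non-degenerate.

The three kinds of derivation have intrinsic descriptions. D_b is b·∂_{S(b)}, formally the bracket
with the non-existent b²/2. D_0 is the projection to the odd part, a derivation because 2 = 0. The
top derivation is the bracket with the product X̄ of all indeterminates, which lies outside the
derived algebra.

An odd centre forces p(B) + p(D) = 1, which excludes D_b for odd N and D_0 for even N; for odd N,
D_0 has the right parity but does not preserve the form. The remaining derivations are self-adjoint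
with square zero. As the centre of the derived algebra is trivial, D² = ad_A then forces A = 0, and
the datum is unique (`isOddCentredDatum_iff`).

For the top derivation, invariance turns the cocycle B(Dx, y) = ∫{X̄, x}y into ∫X̄{x, y}, the
constant term of {x, y} (`leOneForm_derivTop_left`). The double extension thus restores exactly the
two missing monomials, c as the constant 1 and D as X̄, and gives back the Buttin superalgebra
(`nisIsomorphic_derivTop`). -/

lemma mul_comm' (f g : Fn K N) : mul f g = mul g f := by
  funext S
  simp only [mul]
  refine Finset.sum_nbij' (fun T => S \ T) (fun T => S \ T) ?_ ?_ ?_ ?_ ?_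
  · intro T _; simp
  · intro T _; simp
  · intro T hT; exact Finset.sdiff_sdiff_eq_self (Finset.mem_powerset.1 hT)
  · intro T hT; exact Finset.sdiff_sdiff_eq_self (Finset.mem_powerset.1 hT)
  · intro T hT
    rw [Finset.sdiff_sdiff_eq_self (Finset.mem_powerset.1 hT), mul_comm]

lemma mul_assoc' (f g h : Fn K N) : mul (mul f g) h = mul f (mul g h) := by
  funext S
  simp only [mul, Finset.sum_mul, Finset.mul_sum]
  rw [Finset.sum_sigma', Finset.sum_sigma']
  refine Finset.sum_nbij' (fun s => ⟨s.2, s.1 \ s.2⟩) (fun s => ⟨s.1 ∪ s.2, s.1⟩) ?_ ?_ ?_ ?_ ?_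
  · rintro ⟨T, U⟩ h
    simp only [Finset.mem_sigma, Finset.mem_powerset] at h ⊢
    exact ⟨h.2.trans h.1, Finset.sdiff_subset_sdiff h.1 le_rfl⟩
  · rintro ⟨T, U⟩ h
    simp only [Finset.mem_sigma, Finset.mem_powerset] at h ⊢
    exact ⟨Finset.union_subset h.1 (h.2.trans Finset.sdiff_subset), Finset.subset_union_left⟩
  · rintro ⟨T, U⟩ h
    simp only [Finset.mem_sigma, Finset.mem_powerset] at h
    simp [Finset.union_sdiff_of_subset h.2]
  · rintro ⟨T, U⟩ h
    simp only [Finset.mem_sigma, Finset.mem_powerset] at h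
    have : Disjoint T U := (Finset.disjoint_sdiff (s := T) (t := S)).mono_right h.2
    simp [Finset.union_sdiff_cancel_left this]
  · rintro ⟨T, U⟩ h
    simp only [Finset.mem_sigma, Finset.mem_powerset] at h
    have : (S \ U) \ (T \ U) = S \ T := by
      ext v
      have := @h.1 v
      have := @h.2 v
      simp only [Finset.mem_sdiff]
      tauto
    rw [this, mul_assoc]

lemma add_mul' (f g h : Fn K N) : mul (f + g) h = mul f h + mul g h := by
  funext S
  simp [mul, add_mul, Finset.sum_add_distrib]

lemma smul_mul' (r : K) (f g : Fn K N) : mul (r • f) g = r • mul f g := by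
  funext S
  simp [mul, Finset.mul_sum, mul_assoc]

lemma mul_add' (f g h : Fn K N) : mul f (g + h) = mul f g + mul f h := by
  rw [mul_comm', add_mul', mul_comm' g, mul_comm' h]

lemma mul_smul'' (r : K) (f g : Fn K N) : mul f (r • g) = r • mul f g := by
  rw [mul_comm', smul_mul', mul_comm' g]

variable (K N) in
/-- The space of functions, with its multiplication. -/
def Alg := Fn K N

instance : AddCommGroup (Alg K N) := inferInstanceAs (AddCommGroup (Fn K N))

/-- The copy `Alg` is needed because `Fn K N`, as a type of functions, already carries the pointwise
product. It lets the identities for abstract derivations of a commutative ring be applied. -/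
instance : CommRing (Alg K N) where
  __ := (inferInstance : AddCommGroup (Alg K N))
  mul := mul
  one := mono K N ∅
  mul_assoc := mul_assoc'
  mul_comm := mul_comm'
  left_distrib := mul_add'
  right_distrib := add_mul'
  zero_mul := zero_mul'
  mul_zero f := (mul_comm' f 0).trans (zero_mul' f)
  one_mul := mono_empty_mul
  mul_one f := (mul_comm' f _).trans (mono_empty_mul f)

lemma mono_mul (T : Finset (Var N)) (g : Fn K N) (S : Finset (Var N)) :
    mul (mono K N T) g S = if T ⊆ S then g (S \ T) else 0 := by
  simp only [mul, mono, Pi.single_apply, ite_mul, one_mul, zero_mul]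
  rw [Finset.sum_ite_eq']
  simp

lemma pd_add (v : Var N) (f g : Fn K N) : pd v (f + g) = pd v f + pd v g := by
  funext S
  by_cases h : v ∈ S <;> simp [pd, h]

lemma pd_smul (v : Var N) (r : K) (f : Fn K N) : pd v (r • f) = r • pd v f := by
  funext S
  by_cases h : v ∈ S <;> simp [pd, h]

lemma pd_self (v : Var N) (f : Fn K N) : pd v (pd v f) = 0 := by
  funext S
  simp [pd]

lemma pd_comm (v w : Var N) (f : Fn K N) : pd v (pd w f) = pd w (pd v f) := by
  funext S
  simp only [pd, Finset.mem_insert, Finset.insert_comm v w]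
  by_cases hvw : v = w
  · subst hvw; simp
  · by_cases hv : v ∈ S <;> by_cases hw : w ∈ S <;> simp [hv, hw, hvw, Ne.symm hvw]

lemma pd_univ (v : Var N) (f : Fn K N) : pd v f Finset.univ = 0 := by
  simp [pd]

lemma add_self' [CharP K 2] (f : Fn K N) : f + f = 0 := by
  funext S
  exact CharTwo.add_self_eq_zero _

lemma neg_eq' [CharP K 2] (f : Fn K N) : -f = f := by
  funext S
  exact CharTwo.neg_eq _

/-- The Leibniz rule for partial derivatives. -/
lemma pd_mul [CharP K 2] (v : Var N) (f g : Fn K N) :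
    pd v (mul f g) = mul (pd v f) g + mul f (pd v g) := by
  funext S
  have key : ∀ R : Finset (Var N), v ∉ R → ∀ T ∈ R.powerset,
      v ∉ T ∧ insert v R \ T = insert v (R \ T) ∧ insert v R \ insert v T = R \ T := by
    intro R hR T hT
    have hvT : v ∉ T := fun h => hR (Finset.mem_powerset.1 hT h)
    refine ⟨hvT, Finset.insert_sdiff_of_notMem _ hvT, ?_⟩
    rw [Finset.insert_sdiff_insert, Finset.sdiff_insert_of_notMem hR]
  -- If v ∈ S the left side is 0, while on the right both summands produce the same products, with v
  -- in both factors; these cancel because 2 = 0.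
  by_cases hv : v ∈ S
  · obtain ⟨R, hR, rfl⟩ : ∃ R, v ∉ R ∧ insert v R = S :=
      ⟨S.erase v, Finset.notMem_erase v S, Finset.insert_erase hv⟩
    simp only [Pi.add_apply, mul]
    rw [Finset.sum_powerset_insert hR, Finset.sum_powerset_insert hR]
    have h1 : ∑ T ∈ R.powerset, pd v f (insert v T) * g (insert v R \ insert v T) = 0 :=
      Finset.sum_eq_zero fun T _ => by simp [pd]
    have h2 : ∑ T ∈ R.powerset, f T * pd v g (insert v R \ T) = 0 :=
      Finset.sum_eq_zero fun T hT => by simp [pd, (key R hR T hT).1]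
    rw [h1, h2, add_zero, zero_add, ← Finset.sum_add_distrib, Finset.sum_eq_zero]
    · simp [pd]
    · intro T hT
      obtain ⟨a, b, c⟩ := key R hR T hT
      have : v ∉ R \ T := fun h => hR (Finset.mem_sdiff.1 h).1
      rw [c, b]
      simp only [pd, a, this, if_false]
      exact CharTwo.add_self_eq_zero _
  · simp only [Pi.add_apply, mul]
    have h0 : pd v (mul f g) S
        = ∑ T ∈ (insert v S).powerset, f T * g (insert v S \ T) := by
      simp [pd, mul, hv]
    rw [h0, Finset.sum_powerset_insert hv, add_comm]
    congr 1
    · refine Finset.sum_congr rfl fun T hT => ?_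
      obtain ⟨a, b, c⟩ := key S hv T hT
      simp [pd, a, c]
    · refine Finset.sum_congr rfl fun T hT => ?_
      obtain ⟨a, b, c⟩ := key S hv T hT
      have : v ∉ S \ T := fun h => hv (Finset.mem_sdiff.1 h).1
      simp [pd, this, b]

end Algebra

/-! ### Jacobi identities for commuting derivations of a commutative ring -/

section Derivations

variable {A ι : Type*} [CommRing A] [Fintype ι]

/-- The Jacobi identity for the bracket defined by commuting derivations with square zero. -/
lemma bracket_jacobi (s : ι → ι) (hs : Function.Involutive s)
    (d : ι → A → A) (hadd : ∀ v f g, d v (f + g) = d v f + d v g)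
    (hmul : ∀ v f g, d v (f * g) = d v f * g + f * d v g)
    (hcomm : ∀ v w f, d v (d w f) = d w (d v f)) (h2 : (2 : A) = 0) (x y z : A) :
    ∑ v, d v x * d (s v) (∑ w, d w y * d (s w) z) =
      ∑ v, d v (∑ w, d w x * d (s w) y) * d (s v) z +
      ∑ v, d v y * d (s v) (∑ w, d w x * d (s w) z) := by
  have hsum : ∀ v (F : ι → A), d v (∑ w, F w) = ∑ w, d v (F w) := by
    intro v F
    exact map_sum (AddMonoidHom.mk' (d v) (hadd v)) F Finset.univ
  simp only [hsum, hmul, mul_add, add_mul, Finset.sum_add_distrib, Finset.mul_sum,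
    Finset.sum_mul]
  -- After Leibniz, the terms with second derivatives of y and of z match across the equation. The
  -- two sums with second derivatives of x both stand on the right; they are equal and cancel.
  have hA : ∑ v, ∑ w, d v x * (d (s v) (d w y) * d (s w) z) =
      ∑ v, ∑ w, d w x * d v (d (s w) y) * d (s v) z := by
    rw [Finset.sum_comm]
    refine Finset.sum_congr rfl fun v _ => Finset.sum_congr rfl fun w _ => ?_
    rw [hcomm, mul_assoc]
  have hB : ∑ v, ∑ w, d v x * (d w y * d (s v) (d (s w) z)) =
      ∑ v, ∑ w, d v y * (d w x * d (s v) (d (s w) z)) := by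
    rw [Finset.sum_comm]
    refine Finset.sum_congr rfl fun v _ => Finset.sum_congr rfl fun w _ => ?_
    rw [hcomm]; ring
  have hC : ∑ v, ∑ w, d v (d w x) * d (s w) y * d (s v) z =
      ∑ v, ∑ w, d v y * (d (s v) (d w x) * d (s w) z) := by
    rw [Finset.sum_comm, ← Equiv.sum_comp hs.toPerm]
    refine Finset.sum_congr rfl fun v _ => Finset.sum_congr rfl fun w _ => ?_
    simp only [Function.Involutive.coe_toPerm, hs v]
    rw [hcomm]; ring
  rw [hA, hB, hC]
  linear_combination (-(∑ v, ∑ w, d v y * (d (s v) (d w x) * d (s w) z))) * h2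

/-- The iterated bracket with `f` is a contraction of derivatives of products
`d v f * d (s v) f`. -/
lemma bracket_bracket_self (s : ι → ι)
    (d : ι → A → A) (hadd : ∀ v f g, d v (f + g) = d v f + d v g)
    (hmul : ∀ v f g, d v (f * g) = d v f * g + f * d v g)
    (hcomm : ∀ v w f, d v (d w f) = d w (d v f)) (hself : ∀ v f, d v (d v f) = 0)
    (h2 : (2 : A) = 0) (f x : A) :
    ∑ v, d v f * d (s v) (∑ w, d w f * d (s w) x) =
      ∑ w, (∑ v, d v f * d w (d (s v) f)) * d (s w) x := by
  have hsum : ∀ v (F : ι → A), d v (∑ w, F w) = ∑ w, d v (F w) := by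
    intro v F
    exact map_sum (AddMonoidHom.mk' (d v) (hadd v)) F Finset.univ
  simp only [hsum, hmul, mul_add, Finset.sum_add_distrib, Finset.mul_sum, Finset.sum_mul]
  -- The terms with second derivatives of x are symmetric in v and w, so they cancel in pairs; the
  -- diagonal vanishes since each derivation has square zero.
  have hB : ∑ v, ∑ w, d v f * (d w f * d (s v) (d (s w) x)) = 0 := by
    rw [← Finset.sum_product']
    refine Finset.sum_involution (fun p _ => (p.2, p.1)) ?_ ?_ ?_ ?_
    · rintro ⟨v, w⟩ _
      simp only
      rw [hcomm (s w)]
      linear_combination (d v f * (d w f * d (s v) (d (s w) x))) * h2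
    · rintro ⟨v, w⟩ _ hne h
      obtain rfl : w = v := (Prod.mk.inj h).1
      simp [hself] at hne
    · simp
    · simp
  rw [hB, add_zero, Finset.sum_comm]
  refine Finset.sum_congr rfl fun v _ => Finset.sum_congr rfl fun w _ => ?_
  rw [hcomm, mul_assoc]

end Derivations

/-! ### Parity of derivatives and products -/

section Parity

variable {K : Type*} [Field K] {N : ℕ}

lemma degPi_insert {v : Var N} {S : Finset (Var N)} (h : v ∉ S) :
    degPi (insert v S) = degPi S + if v.isRight then 1 else 0 := by
  simp only [degPi, Finset.filter_insert]
  by_cases hv : v.isRight = true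
  · simp [hv, h]
  · simp [hv]

lemma degPi_sdiff {S T : Finset (Var N)} (h : T ⊆ S) : degPi T + degPi (S \ T) = degPi S := by
  have : S = T ∪ (S \ T) := (Finset.union_sdiff_of_subset h).symm
  conv_rhs => rw [this]
  rw [degPi, degPi, degPi, Finset.filter_union, Finset.card_union_of_disjoint]
  exact Finset.disjoint_filter_filter Finset.disjoint_sdiff

lemma degPi_univ : degPi (Finset.univ : Finset (Var N)) = N := by
  rw [degPi, Finset.card_filter, Fintype.sum_sum_type]
  simp

lemma pd_mem_part {i : ZMod 2} {f : Fn K N} (hf : f ∈ (buttin K N).part i) (v : Var N) :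
    pd v f ∈ (buttin K N).part (i + if v.isRight then 1 else 0) := by
  intro S hS
  have hv : v ∉ S := fun h => hS (by simp [pd, h])
  have := hf (insert v S) (by simpa [pd, hv] using hS)
  rw [degPi_insert hv] at this
  rw [← this]
  split_ifs
  · push_cast
    linear_combination -(CharTwo.two_eq_zero (R := ZMod 2))
  · simp

/-- The product is even for the parity of functions; the reversed parity of the superalgebra
accounts for the shift by 1. -/
lemma mul_mem_part {i j : ZMod 2} {f g : Fn K N} (hf : f ∈ (buttin K N).part i)
    (hg : g ∈ (buttin K N).part j) : mul f g ∈ (buttin K N).part (i + j + 1) := by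
  intro S hS
  obtain ⟨T, hT, h⟩ := Finset.exists_ne_zero_of_sum_ne_zero hS
  rw [← hf T (left_ne_zero_of_mul h), ← hg _ (right_ne_zero_of_mul h),
    ← degPi_sdiff (Finset.mem_powerset.1 hT)]
  push_cast
  linear_combination -(CharTwo.two_eq_zero (R := ZMod 2))

lemma mono_mem_part (S : Finset (Var N)) :
    mono K N S ∈ (buttin K N).part ((degPi S : ZMod 2) + 1) := by
  intro T hT
  have : T = S := by
    by_contra h
    exact hT (by simp [mono, h])
  rw [this]

end Parity

/-! ### The Berezin integral -/

section Integral

variable {K : Type*} [Field K] {N : ℕ}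

lemma berezin_add (f g : Fn K N) : berezin (f + g) = berezin f + berezin g := rfl

lemma berezin_smul (r : K) (f : Fn K N) : berezin (r • f) = r * berezin f := rfl

lemma berezin_sum {ι : Type*} (s : Finset ι) (F : ι → Fn K N) :
    berezin (∑ i ∈ s, F i) = ∑ i ∈ s, berezin (F i) := by
  simp [berezin]

/-- Integration by parts. -/
lemma berezin_pd_mul [CharP K 2] (v : Var N) (f g : Fn K N) :
    berezin (mul (pd v f) g) = berezin (mul f (pd v g)) := by
  have h : berezin (pd v (mul f g)) = 0 := pd_univ v _
  rw [pd_mul, berezin_add] at h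
  exact CharTwo.add_eq_zero.1 h

lemma buttinForm_mono (f : Fn K N) (S : Finset (Var N)) :
    buttinForm K N (mono K N S) f = f Sᶜ := by
  simp [buttinForm, berezin, mono_mul, Finset.compl_eq_univ_sdiff]

end Integral

/-! ### The Buttin superalgebra and its form -/

section ButtinAlgebra

variable {K : Type*} [Field K] {N : ℕ}

/-- Summing over all indeterminates treats q and π alike; the only structure left is the involution
`Sum.swap`, as the abstract identities require. -/
lemma bracket_eq_sum (f g : Fn K N) :
    (buttin K N).bracket f g = ∑ v : Var N, mul (pd v f) (pd v.swap g) := by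
  rw [Fintype.sum_sum_type, ← Finset.sum_add_distrib]
  rfl

lemma bracket_add_left (f g h : Fn K N) :
    (buttin K N).bracket (f + g) h = (buttin K N).bracket f h + (buttin K N).bracket g h := by
  simp only [bracket_eq_sum, pd_add, add_mul', Finset.sum_add_distrib]

lemma bracket_smul_left (r : K) (f h : Fn K N) :
    (buttin K N).bracket (r • f) h = r • (buttin K N).bracket f h := by
  simp only [bracket_eq_sum, pd_smul, smul_mul', Finset.smul_sum]

lemma bracket_comm (f g : Fn K N) : (buttin K N).bracket f g = (buttin K N).bracket g f := by
  rw [bracket_eq_sum, bracket_eq_sum, ← Equiv.sum_comp (Equiv.sumComm _ _)]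
  refine Finset.sum_congr rfl fun v _ => ?_
  rw [mul_comm']
  simp

lemma bracket_add_right (f g h : Fn K N) :
    (buttin K N).bracket f (g + h) = (buttin K N).bracket f g + (buttin K N).bracket f h := by
  rw [bracket_comm, bracket_add_left, bracket_comm g, bracket_comm h]

lemma bracket_smul_right (r : K) (f g : Fn K N) :
    (buttin K N).bracket f (r • g) = r • (buttin K N).bracket f g := by
  rw [bracket_comm, bracket_smul_left, bracket_comm g]

lemma sq_smul' (r : K) (f : Fn K N) :
    (buttin K N).sq (r • f) = r ^ 2 • (buttin K N).sq f := by
  simp only [buttin, pd_smul, smul_mul', mul_smul'', Finset.smul_sum, smul_smul, sq]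

lemma sq_add' (f g : Fn K N) :
    (buttin K N).sq (f + g) =
      (buttin K N).sq f + (buttin K N).sq g + (buttin K N).bracket f g := by
  simp only [buttin, pd_add, add_mul', mul_add']
  rw [← Finset.sum_add_distrib, ← Finset.sum_add_distrib]
  refine Finset.sum_congr rfl fun i _ => ?_
  rw [mul_comm' (pd (Sum.inl i) g) (pd (Sum.inr i) f)]
  abel

variable [CharP K 2]

lemma two_eq_zero' : (2 : Alg K N) = 0 := by
  rw [← one_add_one_eq_two]
  exact add_self' (mono K N ∅)

lemma bracket_self' (f : Fn K N) : (buttin K N).bracket f f = 0 := by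
  change ∑ i : Fin N, _ = (0 : Fn K N)
  refine Finset.sum_eq_zero fun i _ => ?_
  rw [mul_comm' (pd (Sum.inr i) f)]
  exact add_self' _

lemma jacobi' (x y z : Fn K N) :
    (buttin K N).bracket x ((buttin K N).bracket y z) =
      (buttin K N).bracket ((buttin K N).bracket x y) z +
        (buttin K N).bracket y ((buttin K N).bracket x z) := by
  simp only [bracket_eq_sum]
  exact bracket_jacobi (A := Alg K N) Sum.swap Sum.swap_swap pd pd_add pd_mul pd_comm
    two_eq_zero' x y z

omit [CharP K 2] in
lemma pd_sum {ι : Type*} (s : Finset ι) (v : Var N) (F : ι → Fn K N) :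
    pd v (∑ i ∈ s, F i) = ∑ i ∈ s, pd v (F i) :=
  map_sum (AddMonoidHom.mk' (pd v) (pd_add v)) F s

/-- Squaring is half of the self-bracket: Leibniz applied to the N summands yields one term for each
of the 2N indeterminates. The result is the coefficient appearing in `bracket_bracket_self`. -/
lemma pd_sq (w : Var N) (f : Fn K N) :
    pd w ((buttin K N).sq f) = ∑ v : Var N, mul (pd v f) (pd w (pd v.swap f)) := by
  rw [Fintype.sum_sum_type, ← Finset.sum_add_distrib]
  simp only [buttin, pd_sum, pd_mul, Sum.swap_inl, Sum.swap_inr]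
  refine Finset.sum_congr rfl fun i _ => ?_
  rw [add_comm, mul_comm' (pd w (pd (Sum.inl i) f))]

lemma sq_bracket' (f x : Fn K N) :
    (buttin K N).bracket ((buttin K N).sq f) x =
      (buttin K N).bracket f ((buttin K N).bracket f x) := by
  rw [bracket_eq_sum ((buttin K N).sq f)]
  simp only [pd_sq]
  simp only [bracket_eq_sum]
  exact (bracket_bracket_self (A := Alg K N) Sum.swap pd pd_add pd_mul pd_comm pd_self
    two_eq_zero' f x).symm

omit [CharP K 2] in
lemma bracket_mem_part {i j : ZMod 2} {f g : Fn K N} (hf : f ∈ (buttin K N).part i)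
    (hg : g ∈ (buttin K N).part j) : (buttin K N).bracket f g ∈ (buttin K N).part (i + j) := by
  have key : ∀ v : Var N, mul (pd v f) (pd v.swap g) ∈ (buttin K N).part (i + j) := by
    intro v
    have := mul_mem_part (pd_mem_part hf v) (pd_mem_part hg v.swap)
    convert this using 2
    cases v <;> simp <;> linear_combination -(CharTwo.two_eq_zero (R := ZMod 2))
  rw [bracket_eq_sum]
  exact Submodule.sum_mem _ fun v _ => key v

omit [CharP K 2] in
lemma sq_mem_part {i : ZMod 2} {f : Fn K N} (hf : f ∈ (buttin K N).part i) :
    (buttin K N).sq f ∈ (buttin K N).part 0 := by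
  change ∑ i : Fin N, mul (pd (Sum.inl i) f) (pd (Sum.inr i) f) ∈ _
  refine Submodule.sum_mem _ fun k _ => ?_
  have := mul_mem_part (pd_mem_part hf (Sum.inl k)) (pd_mem_part hf (Sum.inr k))
  convert this using 2
  simp only [Sum.isRight_inl, Sum.isRight_inr]
  simp only [Bool.false_eq_true, if_false, if_true]
  linear_combination -(i + 1) * (CharTwo.two_eq_zero (R := ZMod 2))

omit [CharP K 2] in
lemma part_disjoint : Disjoint ((buttin K N).part 0) ((buttin K N).part 1) := by
  rw [Submodule.disjoint_def]
  intro f h0 h1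
  funext S
  by_contra hS
  exact zero_ne_one ((h0 S hS).symm.trans (h1 S hS))

/-- The homogeneous component of parity `i` of a function. -/
def component (i : ZMod 2) (f : Fn K N) : Fn K N :=
  fun S => if (degPi S : ZMod 2) + 1 = i then f S else 0

omit [CharP K 2] in
lemma component_mem (i : ZMod 2) (f : Fn K N) : component i f ∈ (buttin K N).part i := by
  intro S hS
  by_contra h
  exact hS (by simp [component, h])

omit [CharP K 2] in
lemma component_add (f : Fn K N) : component 0 f + component 1 f = f := by
  funext S
  simp only [Pi.add_apply, component]
  have : ∀ d : ZMod 2, d + 1 = 0 ∧ d + 1 ≠ 1 ∨ d + 1 = 1 ∧ d + 1 ≠ 0 := by decide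
  rcases this (degPi S) with h | h <;> simp [h.1]

theorem isLieSuperalgebra_buttin : IsLieSuperalgebra (buttin K N) where
  isCompl := ⟨part_disjoint, by
    rw [codisjoint_iff, eq_top_iff]
    intro f _
    rw [← component_add f]
    exact Submodule.add_mem_sup (component_mem 0 f) (component_mem 1 f)⟩
  add_bracket := bracket_add_left
  smul_bracket := bracket_smul_left
  bracket_add := bracket_add_right
  bracket_smul r x y := bracket_smul_right r x y
  bracket_mem _ _ _ hx _ hy := bracket_mem_part hx hy
  even_self x _ := bracket_self' x
  antisymm x y := by rw [neg_eq', bracket_comm]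
  jacobi := jacobi'
  sq_mem _ hf := sq_mem_part hf
  sq_smul r f _ := sq_smul' r f
  sq_add f _ h _ := sq_add' f h
  sq_bracket f _ x := sq_bracket' f x

omit [CharP K 2] in
lemma buttinForm_symm (f g : Fn K N) : buttinForm K N f g = buttinForm K N g f := by
  rw [buttinForm, mul_comm']
  rfl

omit [CharP K 2] in
lemma buttinForm_add_left (f g h : Fn K N) :
    buttinForm K N (f + g) h = buttinForm K N f h + buttinForm K N g h := by
  simp only [buttinForm, add_mul', berezin_add]

omit [CharP K 2] in
lemma buttinForm_smul_left (r : K) (f h : Fn K N) :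
    buttinForm K N (r • f) h = r * buttinForm K N f h := by
  simp only [buttinForm, smul_mul', berezin_smul]

omit [CharP K 2] in
lemma buttinForm_eq_sum (f g : Fn K N) : buttinForm K N f g = ∑ S, f S * g Sᶜ := by
  simp [buttinForm, berezin, mul, Finset.compl_eq_univ_sdiff]

/-- This is the obstruction to invariance left by integration by parts; it vanishes because each
pair (q_i, π_i) contributes twice. -/
lemma sum_pd_pd_swap (f : Fn K N) : ∑ v : Var N, pd v (pd v.swap f) = 0 := by
  rw [Fintype.sum_sum_type, ← Finset.sum_add_distrib]
  refine Finset.sum_eq_zero fun i _ => ?_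
  rw [Sum.swap_inl, Sum.swap_inr, pd_comm]
  exact add_self' _

omit [CharP K 2] in
lemma mul_sum' {ι : Type*} (s : Finset ι) (f : Fn K N) (F : ι → Fn K N) :
    mul f (∑ i ∈ s, F i) = ∑ i ∈ s, mul f (F i) :=
  map_sum (AddMonoidHom.mk' (mul f) (mul_add' f)) F s

lemma buttinForm_invariant (x y z : Fn K N) :
    buttinForm K N ((buttin K N).bracket x y) z =
      buttinForm K N x ((buttin K N).bracket y z) := by
  have h1 : ∀ v : Var N, berezin (mul (mul (pd v x) (pd v.swap y)) z) =
      berezin (mul (mul x z) (pd v (pd v.swap y))) +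
        berezin (mul x (mul (pd v.swap y) (pd v z))) := by
    intro v
    rw [mul_assoc', berezin_pd_mul, pd_mul, mul_add', berezin_add, mul_comm' _ z, mul_assoc']
  rw [buttinForm_symm, buttinForm, bracket_eq_sum, bracket_eq_sum, mul_sum', berezin_sum,
    buttinForm, mul_sum', berezin_sum]
  simp only [mul_comm' z, h1]
  rw [Finset.sum_add_distrib, ← berezin_sum, ← mul_sum', sum_pd_pd_swap, mul_comm', zero_mul',
    ← Equiv.sum_comp (Equiv.sumComm _ _)]
  simp [berezin]

omit [CharP K 2] in
lemma buttinForm_homogeneous {i j : ZMod 2} (hij : i + j ≠ N) {f g : Fn K N}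
    (hf : f ∈ (buttin K N).part i) (hg : g ∈ (buttin K N).part j) : buttinForm K N f g = 0 := by
  by_contra h
  apply hij
  have := mul_mem_part hf hg Finset.univ h
  rw [degPi_univ] at this
  linear_combination -this

/-- The terms for T and S \ T agree and cancel, and T = S \ T is impossible for nonempty S. So f² is
a constant. -/
lemma mul_self_apply (f : Fn K N) {S : Finset (Var N)} (hS : S ≠ ∅) : mul f f S = 0 := by
  refine Finset.sum_involution (fun T _ => S \ T) ?_ ?_ ?_ ?_
  · intro T hT
    rw [Finset.sdiff_sdiff_eq_self (Finset.mem_powerset.1 hT), mul_comm (f (S \ T))]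
    exact CharTwo.add_self_eq_zero _
  · intro T _ _ h
    obtain ⟨v, hv⟩ := Finset.nonempty_iff_ne_empty.2 hS
    have := Finset.ext_iff.1 h v
    simp [hv] at this
  · simp
  · intro T hT
    exact Finset.sdiff_sdiff_eq_self (Finset.mem_powerset.1 hT)

lemma buttinForm_self (hN : N ≠ 0) (f : Fn K N) : buttinForm K N f f = 0 := by
  have : Nonempty (Var N) := ⟨Sum.inl ⟨0, Nat.pos_of_ne_zero hN⟩⟩
  exact mul_self_apply f Finset.univ_nonempty.ne_empty

theorem isNIS_buttin (hN : N ≠ 0) : IsNIS (buttin K N) (buttinForm K N) (N : ZMod 2) where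
  add_left := buttinForm_add_left
  smul_left := buttinForm_smul_left
  symm := buttinForm_symm
  odd_self f _ := buttinForm_self hN f
  invariant := buttinForm_invariant
  nondegenerate x hx := by
    funext S
    have := hx (mono K N Sᶜ)
    rwa [buttinForm_symm, buttinForm_mono, compl_compl] at this
  homogeneous _ _ hij _ hx _ hy := buttinForm_homogeneous hij hx hy

/-- Squares have no monomial of highest degree. -/
lemma sq_univ (hN : 2 ≤ N) (f : Fn K N) : (buttin K N).sq f Finset.univ = 0 := by
  simp only [buttin, Finset.sum_apply]
  refine Finset.sum_eq_zero fun i _ => ?_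
  change buttinForm K N _ _ = 0
  rw [buttinForm_eq_sum]
  obtain ⟨j, hj⟩ : ∃ j : Fin N, j ≠ i := by
    have : Nontrivial (Fin N) := Fin.nontrivial_iff_two_le.2 hN
    exact exists_ne i
  set P : Finset (Var N) := {Sum.inl i, Sum.inr i} with hP
  have hmem : ∀ a, a ∈ P ↔ a = Sum.inl i ∨ a = Sum.inr i := by simp [hP]
  have hsub : ∀ S : Finset (Var N),
      pd (Sum.inl i) f S * pd (Sum.inr i) f Sᶜ ≠ 0 → Sum.inl i ∉ S ∧ Sum.inr i ∈ S := by
    intro S hS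
    constructor
    · intro h; exact hS (by simp [pd, h])
    · by_contra h; exact hS (by simp [pd, h])
  have hinl : ∀ S : Finset (Var N), Sum.inl i ∈ symmDiff Sᶜ P ↔ Sum.inl i ∈ S := by
    intro S; simp [Finset.mem_symmDiff, hmem]
  have hinr : ∀ S : Finset (Var N), Sum.inr i ∈ symmDiff Sᶜ P ↔ Sum.inr i ∈ S := by
    intro S; simp [Finset.mem_symmDiff, hmem]
  -- Nonzero terms have S = T ∪ {π_i} with T free of q_i and π_i, and equal f(T ∪ P) f(T' ∪ P),
  -- where T' is the complement of T among the other indeterminates. The involution exchanges T and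
  -- T'; it has no fixed point because another index j exists.
  refine Finset.sum_involution (fun S _ => symmDiff Sᶜ P) ?_ ?_ ?_ ?_
  · intro S _
    by_cases h : Sum.inl i ∉ S ∧ Sum.inr i ∈ S
    · have e1 : insert (Sum.inl i) (symmDiff Sᶜ P) = insert (Sum.inr i) Sᶜ := by
        ext a
        by_cases ha : a = Sum.inl i
        · simp [ha, h.1]
        · by_cases hb : a = Sum.inr i
          · simp [hb, h.2, hinr]
          · simp [ha, hb, hmem, Finset.mem_symmDiff]
      have e2 : insert (Sum.inr i) (symmDiff Sᶜ P)ᶜ = insert (Sum.inl i) S := by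
        ext a
        by_cases ha : a = Sum.inl i
        · simp only [ha, Finset.mem_insert, Finset.mem_compl, hinl, h.1]; simp
        · by_cases hb : a = Sum.inr i
          · simp [hb, h.2]
          · simp only [Finset.mem_insert, Finset.mem_compl, Finset.mem_symmDiff, hmem, ha, hb]
            simp
      simp only [pd, e1, e2, Finset.mem_compl, hinl, hinr, h.1, h.2, if_false, not_true_eq_false]
      rw [mul_comm]
      exact CharTwo.add_self_eq_zero _
    · have h' : ¬ (Sum.inl i ∉ symmDiff Sᶜ P ∧ Sum.inr i ∈ symmDiff Sᶜ P) := by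
        rwa [hinl, hinr]
      rw [not_not.1 fun hne => h (hsub _ hne), not_not.1 fun hne => h' (hsub _ hne), add_zero]
  · intro S _ _ h
    have := Finset.ext_iff.1 h (Sum.inl j)
    simp [Finset.mem_symmDiff, hmem, hj] at this
  · simp
  · intro S _
    ext a
    simp only [Finset.mem_compl, Finset.mem_symmDiff]
    tauto

/-- The top coefficient is the pairing with the constant 1, which invariance moves to the pairing of
f with the bracket of g and 1, and that bracket is zero. -/
lemma bracket_univ (f g : Fn K N) : (buttin K N).bracket f g Finset.univ = 0 := by
  have h := buttinForm_invariant f g (mono K N ∅)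
  rw [buttinForm_symm, buttinForm_mono, Finset.compl_empty] at h
  rw [h, bracket_eq_sum]
  simp [pd_mono, mul_comm' _ 0, zero_mul', buttinForm, berezin]

end ButtinAlgebra
-- The derived algebra and its induced form
section DerivedAlgebra

variable {K : Type*} [Field K] {N : ℕ}

/-- The constant-free part of a function. -/
def trunc : Fn K N →ₗ[K] Fn K N := rep K N ∘ₗ (constants K N).mkQ

lemma trunc_apply (f : Fn K N) (S : Finset (Var N)) :
    trunc f S = if S = ∅ then 0 else f S := rfl

lemma pd_trunc (v : Var N) (f : Fn K N) : pd v (trunc f) = pd v f := by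
  funext S
  simp [pd, trunc_apply]

lemma bracket_trunc_left (f g : Fn K N) :
    (buttin K N).bracket (trunc f) g = (buttin K N).bracket f g := by
  simp only [bracket_eq_sum, pd_trunc]

lemma bracket_trunc_right (f g : Fn K N) :
    (buttin K N).bracket f (trunc g) = (buttin K N).bracket f g := by
  simp only [bracket_eq_sum, pd_trunc]

lemma trunc_mem {i : ZMod 2} {f : Fn K N} (hf : f ∈ (buttin K N).part i) :
    trunc f ∈ (buttin K N).part i := by
  intro S hS
  by_cases h : S = ∅
  · simp [trunc_apply, h] at hS
  · exact hf S (by simpa [trunc_apply, h] using hS)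

lemma mkQ_eq_iff (f g : Fn K N) :
    (constants K N).mkQ f = (constants K N).mkQ g ↔ trunc f = trunc g := by
  refine ⟨fun h => congrArg (rep K N) h, fun h => ?_⟩
  rw [Submodule.mkQ_apply, Submodule.mkQ_apply, Submodule.Quotient.eq, constants,
    Submodule.mem_span_singleton]
  refine ⟨f ∅ - g ∅, ?_⟩
  funext S
  by_cases hS : S = ∅
  · subst hS; simp [mono]
  · have := congrFun h S
    simp only [trunc_apply, hS, if_false] at this
    simp [mono, hS, this]

lemma rep_injective : Function.Injective (rep K N) := by
  intro x y h
  obtain ⟨f, rfl⟩ := Submodule.mkQ_surjective _ x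
  obtain ⟨g, rfl⟩ := Submodule.mkQ_surjective _ y
  exact (mkQ_eq_iff f g).2 h

lemma mkQ_rep (x : LeSpace K N) : (constants K N).mkQ (rep K N x) = x := by
  apply rep_injective
  obtain ⟨f, rfl⟩ := Submodule.mkQ_surjective _ x
  funext S
  change trunc (trunc f) S = trunc f S
  by_cases h : S = ∅ <;> simp [trunc_apply, h]

lemma rep_empty (x : LeSpace K N) : rep K N x ∅ = 0 := by
  obtain ⟨f, rfl⟩ := Submodule.mkQ_surjective _ x
  rfl

lemma mem_le_part {i : ZMod 2} (x : LeSpace K N) :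
    x ∈ (le K N).part i ↔ rep K N x ∈ (buttin K N).part i := by
  constructor
  · rintro ⟨f, hf, rfl⟩
    exact trunc_mem hf
  · intro h
    exact ⟨_, h, mkQ_rep x⟩

/-- The constant-free representative of an element of `𝔩𝔢⁽¹⁾(N|N)`. -/
def repOne : LeOneSpace K N →ₗ[K] Fn K N := rep K N ∘ₗ (LeOneSpace K N).subtype

lemma repOne_injective : Function.Injective (repOne (K := K) (N := N)) :=
  rep_injective.comp Subtype.val_injective

@[simp] lemma repOne_empty (x : LeOneSpace K N) : repOne x ∅ = 0 := rep_empty _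

/-- The element of `𝔩𝔢⁽¹⁾(N|N)` represented by a function without the monomial of highest
degree. -/
def ofFn (f : Fn K N) (hf : f Finset.univ = 0) : LeOneSpace K N :=
  ⟨(constants K N).mkQ f, mkQ_mem_leOne f hf⟩

@[simp] lemma repOne_ofFn (f : Fn K N) (hf : f Finset.univ = 0) :
    repOne (ofFn f hf) = trunc f := rfl

lemma mem_leOne_part {i : ZMod 2} {x : LeOneSpace K N} :
    x ∈ (leOne K N).part i ↔ repOne x ∈ (buttin K N).part i := mem_le_part _

lemma repOne_bracket (x y : LeOneSpace K N) :
    repOne ((leOne K N).bracket x y) =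
      trunc ((buttin K N).bracket (repOne x) (repOne y)) := rfl

lemma repOne_sq {x : LeOneSpace K N} (hx : x ∈ (leOne K N).part 1) :
    repOne ((leOne K N).sq x) = trunc ((buttin K N).sq (repOne x)) := by
  have : (x : LeSpace K N) ∈ (le K N).part 1 := hx
  simp only [leOne, derived, this, dif_pos]
  rfl

lemma leOneForm_eq (x y : LeOneSpace K N) :
    leOneForm K N x y = buttinForm K N (repOne x) (repOne y) := rfl

lemma neg_eq_leOne [CharP K 2] (x : LeOneSpace K N) : -x = x := by
  rw [← neg_one_smul K x, CharTwo.neg_eq, one_smul]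

variable [CharP K 2]

/-- Converse of `mkQ_mem_leOne`: together they identify the derived algebra with the functions
lacking constant and top terms. -/
lemma repOne_univ (hN : 2 ≤ N) (x : LeOneSpace K N) : repOne x Finset.univ = 0 := by
  have hne : (Finset.univ : Finset (Var N)) ≠ ∅ := by
    have : Nonempty (Var N) := ⟨Sum.inl ⟨0, by omega⟩⟩
    exact Finset.univ_nonempty.ne_empty
  obtain ⟨x, hx⟩ := x
  change rep K N x Finset.univ = 0
  induction hx using Submodule.span_induction with
  | mem x hx =>
    rcases hx with ⟨y, z, rfl⟩ | ⟨f, -, rfl⟩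
    · change trunc ((buttin K N).bracket _ _) _ = 0
      rw [trunc_apply, bracket_univ, ite_self]
    · change trunc ((buttin K N).sq _) _ = 0
      rw [trunc_apply, sq_univ hN, ite_self]
  | zero => simp
  | add x y _ _ hx hy => rw [map_add, Pi.add_apply, hx, hy, add_zero]
  | smul r x _ hx => rw [map_smul, Pi.smul_apply, hx, smul_zero]

theorem isLieSuperalgebra_leOne (hN : 2 ≤ N) : IsLieSuperalgebra (leOne K N) where
  isCompl := by
    refine ⟨?_, ?_⟩
    · rw [Submodule.disjoint_def]
      intro x h0 h1
      apply repOne_injective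
      rw [map_zero]
      exact Submodule.disjoint_def.1 part_disjoint _ (mem_leOne_part.1 h0) (mem_leOne_part.1 h1)
    · rw [codisjoint_iff, eq_top_iff]
      intro x _
      have h : ∀ i, component i (repOne x) Finset.univ = 0 := by
        intro i; simp [component, repOne_univ hN x]
      have hx : x = ofFn _ (h 0) + ofFn _ (h 1) := by
        apply repOne_injective
        rw [map_add, repOne_ofFn, repOne_ofFn, ← map_add, component_add]
        funext S
        rw [trunc_apply]
        split_ifs with hS
        · rw [hS, repOne_empty]
        · rfl
      rw [hx]
      exact Submodule.add_mem_sup (mem_leOne_part.2 (trunc_mem (component_mem 0 _)))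
        (mem_leOne_part.2 (trunc_mem (component_mem 1 _)))
  add_bracket x y z := repOne_injective (by
    simp only [map_add, repOne_bracket, bracket_add_left])
  smul_bracket r x y := repOne_injective (by
    simp only [map_smul, repOne_bracket, bracket_smul_left])
  bracket_add x y z := repOne_injective (by
    simp only [map_add, repOne_bracket, bracket_add_right])
  bracket_smul r x y := repOne_injective (by
    simp only [map_smul, repOne_bracket, bracket_smul_right])
  bracket_mem i j x hx y hy := mem_leOne_part.2
    (trunc_mem (bracket_mem_part (mem_leOne_part.1 hx) (mem_leOne_part.1 hy)))
  even_self x _ := repOne_injective (by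
    simp only [repOne_bracket, bracket_self', map_zero])
  antisymm x y := repOne_injective (by
    rw [neg_eq_leOne, repOne_bracket, repOne_bracket, bracket_comm])
  jacobi x y z := repOne_injective (by
    simp only [map_add, repOne_bracket, bracket_trunc_left, bracket_trunc_right]
    rw [← map_add, ← jacobi'])
  sq_mem f hf := mem_leOne_part.2 (by
    rw [repOne_sq hf]
    exact trunc_mem (sq_mem_part (mem_leOne_part.1 hf)))
  sq_smul r f hf := repOne_injective (by
    rw [repOne_sq (Submodule.smul_mem _ r hf), map_smul, map_smul, repOne_sq hf, sq_smul',
      map_smul])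
  sq_add f hf h hh := repOne_injective (by
    rw [repOne_sq (Submodule.add_mem _ hf hh), map_add, map_add, map_add, repOne_sq hf,
      repOne_sq hh, sq_add', map_add, map_add, repOne_bracket])
  sq_bracket f hf x := repOne_injective (by
    simp only [repOne_bracket, repOne_sq hf, bracket_trunc_left, bracket_trunc_right]
    rw [sq_bracket'])

-- The constant coefficient pairs only with the top one, so working modulo constants does not affect
-- the form.
omit [CharP K 2] in
lemma buttinForm_trunc {g : Fn K N} (hg : g Finset.univ = 0) (f : Fn K N) :
    buttinForm K N (trunc f) g = buttinForm K N f g := by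
  rw [buttinForm_eq_sum, buttinForm_eq_sum]
  refine Finset.sum_congr rfl fun S _ => ?_
  by_cases h : S = ∅
  · simp [h, hg]
  · simp [trunc_apply, h]

theorem isNIS_leOne (hN : 2 ≤ N) : IsNIS (leOne K N) (leOneForm K N) (N : ZMod 2) where
  add_left x y z := by simp only [leOneForm_eq, map_add, buttinForm_add_left]
  smul_left r x y := by simp only [leOneForm_eq, map_smul, buttinForm_smul_left]
  symm x y := buttinForm_symm _ _
  odd_self f _ := buttinForm_self (by omega) _
  invariant x y z := by
    simp only [leOneForm_eq, repOne_bracket]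
    rw [buttinForm_trunc (repOne_univ hN z), buttinForm_symm _ (trunc _),
      buttinForm_trunc (repOne_univ hN x), buttinForm_invariant, buttinForm_symm]
  nondegenerate x hx := by
    apply repOne_injective
    funext S
    rw [map_zero, Pi.zero_apply]
    by_cases h0 : S = ∅
    · rw [h0, repOne_empty]
    by_cases h1 : S = Finset.univ
    · rw [h1, repOne_univ hN]
    have := hx (ofFn (mono K N Sᶜ) (by simp [mono, eq_comm, h0]))
    rw [leOneForm_eq, repOne_ofFn, buttinForm_symm, buttinForm_trunc (repOne_univ hN x),
      buttinForm_mono, compl_compl] at this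
    exact this
  homogeneous i j hij x hx y hy :=
    buttinForm_homogeneous hij (mem_leOne_part.1 hx) (mem_leOne_part.1 hy)

end DerivedAlgebra
-- The operators as derivations
section Derivations

variable {K : Type*} [Field K] {N : ℕ}

lemma sumOp_apply (P : Finset (Finset (Var N) × Finset (Var N))) (f : Fn K N)
    (S : Finset (Var N)) : sumOp K N P f S = ∑ s ∈ P, if S = s.1 then f s.2 else 0 := by
  simp [sumOp, unitOp, mono, Pi.single_apply]

lemma swap_ne (b : Var N) : b.swap ≠ b := by
  cases b <;> simp

/-- The derivative kills monomials without S(b), and multiplication by b kills those containing b.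
This replaces the list of matrix units by a first-order differential operator. -/
lemma repOne_derivB (b : Var N) (x : LeOneSpace K N) :
    repOne (derivB K N b x) = trunc (mul (mono K N {b}) (pd b.swap (repOne x))) := by
  have hb := swap_ne b
  change trunc (sumOp K N _ (repOne x)) = _
  congr 1
  funext S
  rw [sumOp_apply, Finset.sum_image]
  · rw [mono_mul]
    by_cases h : b ∈ S ∧ b.swap ∉ S
    · rw [Finset.sum_eq_single (S.erase b)]
      · rw [Finset.insert_erase h.1, if_pos rfl, if_pos (by simpa using h.1)]
        simp [pd, h.2, Finset.sdiff_singleton_eq_erase]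
      · intro T hT hne
        rw [if_neg]
        rintro rfl
        apply hne
        rw [Finset.erase_insert]
        intro hbT
        have := Finset.mem_powerset.1 hT hbT
        simp at this
      · intro hS
        exfalso
        apply hS
        rw [Finset.mem_powerset]
        intro v hv
        have hv' := Finset.mem_erase.1 hv
        simp only [Finset.mem_sdiff, Finset.mem_univ, Finset.mem_insert, Finset.mem_singleton,
          true_and, not_or]
        exact ⟨hv'.1, fun e => h.2 (e ▸ hv'.2)⟩
    · rw [Finset.sum_eq_zero]
      · by_cases hbS : b ∈ S
        · have : b.swap ∈ S := by tauto
          simp [pd, this, hb]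
        · simp [hbS]
      · intro T hT
        rw [if_neg]
        rintro rfl
        apply h
        refine ⟨Finset.mem_insert_self _ _, fun hm => ?_⟩
        have := Finset.mem_powerset.1 hT (Finset.mem_of_mem_insert_of_ne hm hb)
        simp at this
  · intro S hS T hT h
    have h1 : insert b S = insert b T := congrArg Prod.fst h
    have hbn : ∀ U ∈ (Finset.univ \ {b, b.swap} : Finset (Var N)).powerset, b ∉ U := by
      intro U hU hbU
      have := Finset.mem_powerset.1 hU hbU
      simp at this
    rw [← Finset.erase_insert (hbn S hS), h1, Finset.erase_insert (hbn T hT)]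

lemma mono_apply_self (S : Finset (Var N)) : mono K N S S = 1 := by simp [mono]

lemma mono_apply_ne {S T : Finset (Var N)} (h : T ≠ S) : mono K N S T = 0 := by
  simp [mono, h]

lemma trunc_mono {S : Finset (Var N)} (h : S ≠ ∅) : trunc (mono K N S) = mono K N S :=
  rep_mkQ_mono h

lemma degPi_singleton (v : Var N) : degPi {v} = if v.isRight then 1 else 0 := by
  rw [← insert_empty_eq, degPi_insert (Finset.notMem_empty v)]
  simp [degPi]

lemma bracket_mono_singleton (v : Var N) (f : Fn K N) :
    (buttin K N).bracket (mono K N {v}) f = pd v.swap f := by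
  rw [bracket_eq_sum, Finset.sum_eq_single v]
  · rw [pd_mono, if_pos (Finset.mem_singleton_self v), Finset.erase_singleton, mono_empty_mul]
  · intro w _ hw
    rw [pd_mono, if_neg (by simpa using hw), zero_mul']
  · simp

variable [CharP K 2]

/-- Since ∂X̄/∂v lacks only v, its product with ∂_{S(v)} f sees only the constant term of the
latter, apart from a top contribution that is zero in the total bracket. -/
lemma repOne_derivTop (x : LeOneSpace K N) :
    repOne (derivTop K N x) =
      trunc ((buttin K N).bracket (mono K N Finset.univ) (repOne x)) := by
  change trunc (sumOp K N _ (repOne x)) = _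
  congr 1
  funext S
  by_cases hS : S = Finset.univ
  · rw [hS, bracket_univ, sumOp_univ]
    intro s hs hu
    obtain ⟨v, -, rfl⟩ := Finset.mem_image.1 hs
    have := Finset.ext_iff.1 hu v
    simp at this
  rw [sumOp_apply, Finset.sum_image, bracket_eq_sum, Finset.sum_apply]
  · refine Finset.sum_congr rfl fun v _ => ?_
    rw [pd_mono, if_pos (Finset.mem_univ v), mono_mul]
    by_cases h : S = Finset.univ.erase v
    · simp [h, pd]
    · rw [if_neg h, if_neg]
      intro hs
      apply h
      refine Finset.Subset.antisymm (fun w hw => ?_) hs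
      refine Finset.mem_erase.2 ⟨?_, Finset.mem_univ w⟩
      rintro rfl
      apply hS
      rw [Finset.eq_univ_iff_forall]
      intro u
      by_cases hu : u = w
      · rwa [hu]
      · exact hs (by simp [hu])
  · intro v _ w _ h
    have : ({v.swap} : Finset (Var N)) = {w.swap} := congrArg Prod.snd h
    exact Sum.swap_leftInverse.injective (Finset.singleton_injective this)

lemma repOne_derivZero (hN : 2 ≤ N) (x : LeOneSpace K N) :
    repOne (derivZero K N x) = component 1 (repOne x) := by
  change trunc (sumOp K N _ (repOne x)) = _
  funext S
  rw [trunc_apply]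
  by_cases h0 : S = ∅
  · simp [h0, component]
  have h1 : (degPi S : ZMod 2) + 1 = 1 ↔ Even (degPi S) := by
    rw [add_eq_right, ZMod.natCast_eq_zero_iff_even]
  rw [if_neg h0, sumOp_apply, Finset.sum_image (fun _ _ _ _ h => congrArg Prod.fst h),
    Finset.sum_ite_eq]
  simp only [component, h1, Finset.mem_filter, Finset.mem_univ, true_and]
  by_cases hu : S = Finset.univ
  · simp [hu, repOne_univ hN]
  · simp [h0, hu]

omit [CharP K 2] in
/-- An operator on `𝔩𝔢⁽¹⁾(N|N)` induced by an operator on functions that is a derivation up to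
constants is a derivation. -/
lemma isDerivation_of_repOne {D : LeOneSpace K N →ₗ[K] LeOneSpace K N} {p : ZMod 2}
    (E : Fn K N → Fn K N) (hD : ∀ x, repOne (D x) = trunc (E (repOne x)))
    (hpart : ∀ i, ∀ f ∈ (buttin K N).part i, E f ∈ (buttin K N).part (i + p))
    (htrunc : ∀ f, E (trunc f) = E f)
    (hbracket : ∀ f g, E ((buttin K N).bracket f g) =
      (buttin K N).bracket (E f) g + (buttin K N).bracket f (E g))
    (hsq : ∀ f, trunc (E ((buttin K N).sq f)) = trunc ((buttin K N).bracket (E f) f)) :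
    IsDerivation (leOne K N) D p where
  map_part i x hx := mem_leOne_part.2 (by
    rw [hD]
    exact trunc_mem (hpart i _ (mem_leOne_part.1 hx)))
  map_bracket x y := repOne_injective (by
    rw [hD, map_add, repOne_bracket, repOne_bracket, repOne_bracket, hD, hD, htrunc, hbracket,
      bracket_trunc_left, bracket_trunc_right, map_add])
  map_sq f hf := repOne_injective (by
    rw [hD, repOne_sq hf, repOne_bracket, hD, htrunc, hsq, bracket_trunc_left])

lemma bracket_mul_left (a f g : Fn K N) :
    (buttin K N).bracket (mul a f) g =
      mul f ((buttin K N).bracket a g) + mul a ((buttin K N).bracket f g) := by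
  simp only [bracket_eq_sum, pd_mul, mul_sum', ← Finset.sum_add_distrib]
  refine Finset.sum_congr rfl fun v _ => ?_
  rw [add_mul', mul_comm' (pd v a) f, mul_assoc', mul_assoc']

lemma pd_bracket (v : Var N) (f g : Fn K N) :
    pd v ((buttin K N).bracket f g) =
      (buttin K N).bracket (pd v f) g + (buttin K N).bracket f (pd v g) := by
  simp only [bracket_eq_sum, pd_sum, pd_mul, ← Finset.sum_add_distrib, pd_comm v]

lemma pd_sq' (v : Var N) (f : Fn K N) :
    pd v ((buttin K N).sq f) = (buttin K N).bracket (pd v f) f := by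
  rw [pd_sq, bracket_comm, bracket_eq_sum]
  simp only [pd_comm v]

lemma bracket_mono_mul (b : Var N) (f g : Fn K N) :
    (buttin K N).bracket (mul (mono K N {b}) (pd b.swap f)) g =
      mul (pd b.swap f) (pd b.swap g) +
        mul (mono K N {b}) ((buttin K N).bracket (pd b.swap f) g) := by
  rw [bracket_mul_left, bracket_mono_singleton]

theorem isDerivation_derivB (b : Var N) : IsDerivation (leOne K N) (derivB K N b) 1 := by
  refine isDerivation_of_repOne (fun f => mul (mono K N {b}) (pd b.swap f)) (repOne_derivB b)
    ?_ ?_ ?_ ?_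
  · intro i f hf
    have := mul_mem_part (mono_mem_part (K := K) {b}) (pd_mem_part hf b.swap)
    convert this using 2
    rw [degPi_singleton]
    have h2 := CharTwo.two_eq_zero (R := ZMod 2)
    cases b
    · simp; linear_combination -h2
    · simp; linear_combination h2
  · intro f
    simp only [pd_trunc]
  · intro f g
    rw [bracket_mono_mul, bracket_comm f (mul _ _), bracket_mono_mul, pd_bracket, mul_add',
      bracket_comm (pd b.swap g), mul_comm' (pd b.swap g)]
    -- The failure of b·∂_{S(b)} to be a derivation is ∂_{S(b)}f · ∂_{S(b)}g, which arises once from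
    -- each argument.
    have h := add_self' (mul (pd b.swap f) (pd b.swap g))
    rw [add_add_add_comm, h, zero_add]
  · intro f
    rw [bracket_mono_mul, pd_sq', map_add]
    -- For squares the error term (∂_{S(b)} f)² occurs once only, but it is a constant and
    -- disappears modulo constants.
    have : trunc (mul (pd b.swap f) (pd b.swap f)) = 0 := by
      funext S
      rw [trunc_apply]
      split_ifs with h
      · rfl
      · exact mul_self_apply _ h
    rw [this, zero_add]

theorem isDerivation_derivTop : IsDerivation (leOne K N) (derivTop K N) ((N : ZMod 2) + 1) := by
  refine isDerivation_of_repOne ((buttin K N).bracket (mono K N Finset.univ)) repOne_derivTop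
    ?_ ?_ ?_ ?_
  · intro i f hf
    have := bracket_mem_part (mono_mem_part (K := K) Finset.univ) hf
    rwa [degPi_univ, add_comm] at this
  · exact bracket_trunc_right _
  · exact jacobi' _
  · intro f
    rw [bracket_comm, sq_bracket', bracket_comm f, bracket_comm f]

end Derivations

/-! ### The projection to the odd part -/

section OddProjection

variable {K : Type*} [Field K] {V : Type*} [AddCommGroup V] [Module K V]

/-- The projection to the odd part is an even derivation in characteristic `2`. -/
lemma isDerivation_of_projection {g : SuperData K V} (hg : IsLieSuperalgebra g)
    (h2 : ∀ x : V, x + x = 0) {D : V →ₗ[K] V} (h0 : ∀ x ∈ g.part 0, D x = 0)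
    (h1 : ∀ x ∈ g.part 1, D x = x) : IsDerivation g D 0 where
  map_part i x hx := by
    rw [add_zero]
    have : i = 0 ∨ i = 1 := (by decide : ∀ i : ZMod 2, i = 0 ∨ i = 1) i
    rcases this with rfl | rfl
    · rw [h0 x hx]; exact Submodule.zero_mem _
    · rwa [h1 x hx]
  map_bracket x y := by
    have split : ∀ z, ∃ a ∈ g.part 0, ∃ b ∈ g.part 1, a + b = z := fun z =>
      Submodule.mem_sup.1 (hg.isCompl.sup_eq_top ▸ Submodule.mem_top)
    obtain ⟨a, ha, b, hb, rfl⟩ := split x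
    obtain ⟨c, hc, d, hd, rfl⟩ := split y
    have e1 := h0 _ (hg.bracket_mem 0 0 a ha c hc)
    have e2 := h1 _ (hg.bracket_mem 0 1 a ha d hd)
    have e3 := h1 _ (hg.bracket_mem 1 0 b hb c hc)
    have e4 := h0 _ (hg.bracket_mem 1 1 b hb d hd)
    simp only [map_add, hg.add_bracket, hg.bracket_add, e1, e2, e3, e4, h0 a ha, h0 c hc,
      h1 b hb, h1 d hd, zero_add, add_zero]
    -- The bracket of the odd parts is even, hence killed by D, whereas Leibniz counts it twice.
    have := h2 (g.bracket b d)
    rw [add_add_add_comm, this, add_zero, add_comm]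
  map_sq f hf := by
    rw [h0 _ (hg.sq_mem f hf), h1 f hf]
    -- Polarizing at (f, f) gives [f, f] = 0, since the square of f + f = 0 is zero.
    have h := hg.sq_add f hf f hf
    have hz := hg.sq_smul 0 f hf
    rw [h2, h2, zero_add] at h
    rw [zero_smul] at hz
    rw [← h, hz]
    simp

end OddProjection

/-! ### Outerness of the derivations -/

section Outer

variable {K : Type*} [Field K] {N : ℕ} [CharP K 2]

lemma derivZero_of_even (hN : 2 ≤ N) {x : LeOneSpace K N} (hx : x ∈ (leOne K N).part 0) :
    derivZero K N x = 0 := by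
  apply repOne_injective
  rw [repOne_derivZero hN, map_zero]
  funext S
  by_contra h
  have h' : repOne x S ≠ 0 ∧ (degPi S : ZMod 2) + 1 = 1 := by
    simp only [component, Pi.zero_apply, ite_eq_right_iff, Classical.not_imp] at h
    exact ⟨h.2, h.1⟩
  exact zero_ne_one ((mem_leOne_part.1 hx S h'.1).symm.trans h'.2)

lemma derivZero_of_odd (hN : 2 ≤ N) {x : LeOneSpace K N} (hx : x ∈ (leOne K N).part 1) :
    derivZero K N x = x := by
  apply repOne_injective
  rw [repOne_derivZero hN]
  funext S
  rw [component]
  split_ifs with h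
  · rfl
  · by_contra hS
    exact h (mem_leOne_part.1 hx S (Ne.symm hS))

theorem isDerivation_derivZero (hN : 2 ≤ N) : IsDerivation (leOne K N) (derivZero K N) 0 :=
  isDerivation_of_projection (isLieSuperalgebra_leOne hN)
    (fun x => repOne_injective (by rw [map_add, add_self', map_zero]))
    (fun _ => derivZero_of_even hN) (fun _ => derivZero_of_odd hN)

/-- The class of a monomial other than the product of all indeterminates. -/
def monoOne (K : Type*) [Field K] {N : ℕ} (S : Finset (Var N)) (hS : S ≠ Finset.univ) :
    LeOneSpace K N :=
  ofFn (mono K N S) (mono_apply_ne hS.symm)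

omit [CharP K 2] in
lemma repOne_monoOne {S : Finset (Var N)} (h : S ≠ Finset.univ) (h' : S ≠ ∅) :
    repOne (monoOne K S h) = mono K N S := by
  rw [monoOne, repOne_ofFn, trunc_mono h']

omit [CharP K 2] in
lemma monoOne_mem_part (S : Finset (Var N)) (hS : S ≠ Finset.univ) :
    monoOne K S hS ∈ (leOne K N).part ((degPi S : ZMod 2) + 1) :=
  mem_leOne_part.2 (trunc_mem (mono_mem_part S))

lemma singleton_ne_univ (v : Var N) : {v} ≠ (Finset.univ : Finset (Var N)) := by
  intro h
  have := Finset.mem_univ v.swap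
  rw [← h, Finset.mem_singleton] at this
  exact swap_ne v this

omit [CharP K 2] in
/-- The bracket with an indeterminate is the partial derivative by its partner. -/
lemma repOne_bracket_singleton (y : LeOneSpace K N) (v : Var N) {S : Finset (Var N)}
    (hS : S ≠ ∅) (hv : v.swap ∉ S) :
    repOne ((leOne K N).bracket y (monoOne K {v} (singleton_ne_univ v))) S =
      repOne y (insert v.swap S) := by
  rw [repOne_bracket, repOne_monoOne _ (Finset.singleton_ne_empty v), bracket_comm,
    bracket_mono_singleton, trunc_apply, if_neg hS, pd, if_neg hv]

omit [CharP K 2] in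
lemma repOne_derivB_singleton (b : Var N) :
    repOne (derivB K N b (monoOne K {b.swap} (singleton_ne_univ _))) = mono K N {b} := by
  rw [repOne_derivB, repOne_monoOne _ (Finset.singleton_ne_empty _), pd_mono,
    if_pos (Finset.mem_singleton_self _), Finset.erase_singleton, mul_comm', mono_empty_mul,
    trunc_mono (Finset.singleton_ne_empty b)]

/-- Any bracket with S(b) is a derivative by b, so it never contains b; but D_b sends S(b) to b. -/
theorem isOuterDerivation_derivB (b : Var N) :
    IsOuterDerivation (leOne K N) (derivB K N b) 1 := by
  refine ⟨isDerivation_derivB b, ?_⟩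
  rintro ⟨y, hy⟩
  have h := congrArg (fun x => repOne x {b}) (hy (monoOne K {b.swap} (singleton_ne_univ _)))
  simp only [repOne_derivB_singleton, mono_apply_self] at h
  rw [repOne_bracket, repOne_monoOne _ (Finset.singleton_ne_empty _), bracket_comm,
    bracket_mono_singleton, trunc_apply] at h
  simp [pd] at h

theorem isOuterDerivation_derivZero (hN : 2 ≤ N) :
    IsOuterDerivation (leOne K N) (derivZero K N) 0 := by
  refine ⟨isDerivation_derivZero hN, ?_⟩
  rintro ⟨y, hy⟩
  let i : Fin N := ⟨0, by omega⟩
  -- The coefficient of q_i π_i in y would have to be 1, tested on q_i, and 0, tested on π_i.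
  have h1 := congrArg (fun x => repOne x {Sum.inl i})
    (hy (monoOne K {Sum.inl i} (singleton_ne_univ _)))
  have h2 := congrArg (fun x => repOne x {Sum.inr i})
    (hy (monoOne K {Sum.inr i} (singleton_ne_univ _)))
  rw [repOne_bracket_singleton y _ (Finset.singleton_ne_empty _) (by simp), derivZero_of_odd hN,
    repOne_monoOne _ (Finset.singleton_ne_empty _), mono_apply_self] at h1
  · rw [repOne_bracket_singleton y _ (Finset.singleton_ne_empty _) (by simp),
      derivZero_of_even hN, map_zero] at h2
    · rw [Sum.swap_inr, Finset.pair_comm, ← Sum.swap_inl, ← h1] at h2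
      exact zero_ne_one h2
    · have := monoOne_mem_part (K := K) {Sum.inr i} (singleton_ne_univ _)
      rw [degPi_singleton] at this
      convert this using 2
      simp [CharTwo.add_self_eq_zero]
  · have := monoOne_mem_part (K := K) {Sum.inl i} (singleton_ne_univ _)
    rw [degPi_singleton] at this
    convert this using 2
    simp

theorem isOuterDerivation_derivTop (hN : 2 ≤ N) :
    IsOuterDerivation (leOne K N) (derivTop K N) ((N : ZMod 2) + 1) := by
  refine ⟨isDerivation_derivTop, ?_⟩
  rintro ⟨y, hy⟩
  let v : Var N := Sum.inl ⟨0, by omega⟩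
  have hne : (Finset.univ : Finset (Var N)).erase v ≠ ∅ := by
    intro h
    have := Finset.ext_iff.1 h v.swap
    simp [v] at this
  -- Testing on S(v) would require y to have top coefficient 1.
  have h := congrArg (fun x => repOne x (Finset.univ.erase v))
    (hy (monoOne K {v.swap} (singleton_ne_univ _)))
  rw [repOne_bracket_singleton y _ hne (by simp), repOne_derivTop,
    repOne_monoOne _ (Finset.singleton_ne_empty _), bracket_comm, bracket_mono_singleton,
    Sum.swap_swap, pd_mono, if_pos (Finset.mem_univ v), trunc_mono hne, mono_apply_self,
    Finset.insert_erase (Finset.mem_univ v), repOne_univ hN] at h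
  exact one_ne_zero h

end Outer
-- Double extension of an even form by an odd square-zero derivation
section DoubleExtension

lemma self_add_self (K : Type*) [Field K] [CharP K 2] {V : Type*} [AddCommGroup V] [Module K V]
    (x : V) : x + x = 0 := by
  rw [← two_smul K x, CharTwo.two_eq_zero, zero_smul]

lemma self_neg (K : Type*) [Field K] [CharP K 2] {V : Type*} [AddCommGroup V] [Module K V]
    (x : V) : -x = x := by
  rw [neg_eq_iff_add_eq_zero]
  exact self_add_self K x

variable {K : Type*} [Field K] [CharP K 2] {V : Type*} [AddCommGroup V] [Module K V]

/-- The double extension by an odd derivation with square zero, relative to an even form. -/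
theorem isLieSuperalgebra_doubleExtension {a : SuperData K V}
    (ha : IsLieSuperalgebra a) {B : V → V → K} (hB : IsNIS a B 0) {D : V →ₗ[K] V}
    (hD : IsDerivation a D 1) (hpres : ∀ x y, B (D x) y = B x (D y))
    (hsq : ∀ x, D (D x) = 0) :
    IsLieSuperalgebra (doubleExtension a B 0 D ⟨1, 0, 0, 0, 0⟩) := by
  have h2 : ∀ x : V, x + x = 0 := self_add_self K
  have hneg : ∀ x : V, -x = x := self_neg K
  have hadd_right : ∀ x y z, B x (y + z) = B x y + B x z := fun x y z => by
    rw [hB.symm, hB.add_left, hB.symm y, hB.symm z]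
  have hsmul_right : ∀ (r : K) x y, B x (r • y) = r * B x y := fun r x y => by
    rw [hB.symm, hB.smul_left, hB.symm y]
  have hmem0 : ∀ x : K × V × K, x ∈ (doubleExtension a B 0 D ⟨1, 0, 0, 0, 0⟩).part 0 ↔
      x.1 = 0 ∧ x.2.1 ∈ a.part 0 ∧ x.2.2 = 0 := by
    intro x
    simp [doubleExtension, Submodule.mem_prod]
  have hmem1 : ∀ x : K × V × K, x ∈ (doubleExtension a B 0 D ⟨1, 0, 0, 0, 0⟩).part 1 ↔
      x.2.1 ∈ a.part 1 := by
    intro x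
    simp [doubleExtension, Submodule.mem_prod]
  have h11 : (1 : ZMod 2) + 1 = 0 := CharTwo.add_self_eq_zero _
  -- Self-adjointness and D² = 0 kill the terms that the D-components contribute to the cocycle.
  have hDD : ∀ x y, B (D x) (D y) = 0 := fun x y => by
    have := hB.smul_left 0 0 y
    rw [zero_smul, zero_mul] at this
    rw [← hpres, hsq, this]
  have hcases : ∀ i : ZMod 2, i = 0 ∨ i = 1 := by decide
  have hD0 : ∀ x ∈ a.part 0, D x ∈ a.part 1 := fun x hx => by
    simpa using hD.map_part 0 x hx
  have hD1 : ∀ x ∈ a.part 1, D x ∈ a.part 0 := fun x hx => by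
    have := hD.map_part 1 x hx
    rwa [h11] at this
  have hcomm : ∀ x y, a.bracket x y = a.bracket y x := fun x y => by
    rw [ha.antisymm, hneg]
  refine
    { isCompl := ?_, add_bracket := ?_, smul_bracket := ?_, bracket_add := ?_,
      bracket_smul := ?_, bracket_mem := ?_, even_self := ?_, antisymm := ?_, jacobi := ?_,
      sq_mem := ?_, sq_smul := ?_, sq_add := ?_, sq_bracket := ?_ }
  · refine ⟨?_, ?_⟩
    · rw [Submodule.disjoint_def]
      rintro ⟨r, x, t⟩ h0 h1
      obtain ⟨rfl, hx, rfl⟩ := (hmem0 _).1 h0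
      have := Submodule.disjoint_def.1 ha.isCompl.disjoint x hx ((hmem1 _).1 h1)
      exact congrArg (fun u : V => ((0, u, 0) : K × V × K)) this
    · rw [codisjoint_iff, eq_top_iff]
      rintro ⟨r, x, t⟩ -
      obtain ⟨y, hy, z, hz, rfl⟩ := Submodule.mem_sup.1
        (ha.isCompl.sup_eq_top ▸ Submodule.mem_top : x ∈ a.part 0 ⊔ a.part 1)
      refine Submodule.mem_sup.2 ⟨(0, y, 0), (hmem0 _).2 ⟨rfl, hy, rfl⟩, (r, z, t),
        (hmem1 _).2 hz, ?_⟩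
      simp
  · rintro ⟨r, x, t⟩ ⟨r', y, t'⟩ ⟨r'', z, t''⟩
    simp only [doubleExtension, Prod.mk_add_mk, Prod.mk.injEq, map_add, hB.add_left,
      ha.add_bracket, add_zero, true_and, and_true]
    module
  · rintro c ⟨r, x, t⟩ ⟨r', y, t'⟩
    simp only [doubleExtension, Prod.smul_mk, Prod.mk.injEq, map_smul, hB.smul_left,
      ha.smul_bracket, smul_eq_mul, mul_zero, true_and, and_true]
    module
  · rintro ⟨r, x, t⟩ ⟨r', y, t'⟩ ⟨r'', z, t''⟩
    simp only [doubleExtension, Prod.mk_add_mk, Prod.mk.injEq, map_add, hadd_right,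
      ha.bracket_add, add_zero, true_and, and_true]
    module
  · rintro c ⟨r, x, t⟩ ⟨r', y, t'⟩
    simp only [doubleExtension, Prod.smul_mk, Prod.mk.injEq, map_smul, hsmul_right,
      ha.bracket_smul, smul_eq_mul, mul_zero, true_and, and_true]
    module
  · rintro i j ⟨r, x, t⟩ hx ⟨r', y, t'⟩ hy
    rcases hcases i with rfl | rfl <;> rcases hcases j with rfl | rfl
    · obtain ⟨rfl, hx', rfl⟩ := (hmem0 _).1 hx
      obtain ⟨rfl, hy', rfl⟩ := (hmem0 _).1 hy
      refine (hmem0 _).2 ⟨?_, ?_, rfl⟩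
      · exact hB.homogeneous 1 0 (by decide) _ (hD0 x hx') y hy'
      · simpa [doubleExtension] using ha.bracket_mem 0 0 x hx' y hy'
    · obtain ⟨rfl, hx', rfl⟩ := (hmem0 _).1 hx
      have hy' := (hmem1 _).1 hy
      rw [zero_add, hmem1]
      simp only [doubleExtension, zero_smul, add_zero]
      exact Submodule.sub_mem _ (by simpa using ha.bracket_mem 0 1 x hx' y hy')
        (Submodule.smul_mem _ _ (hD0 x hx'))
    · obtain ⟨rfl, hy', rfl⟩ := (hmem0 _).1 hy
      have hx' := (hmem1 _).1 hx
      rw [add_zero, hmem1]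
      simp only [doubleExtension, zero_smul, sub_zero]
      exact Submodule.add_mem _ (by simpa using ha.bracket_mem 1 0 x hx' y hy')
        (Submodule.smul_mem _ _ (hD0 y hy'))
    · have hx' := (hmem1 _).1 hx
      have hy' := (hmem1 _).1 hy
      rw [h11]
      refine (hmem0 _).2 ⟨?_, ?_, rfl⟩
      · exact hB.homogeneous 0 1 (by decide) _ (hD1 x hx') y hy'
      · have := ha.bracket_mem 1 1 x hx' y hy'
        rw [h11] at this
        exact Submodule.sub_mem _ (Submodule.add_mem _ this
          (Submodule.smul_mem _ _ (hD1 y hy'))) (Submodule.smul_mem _ _ (hD1 x hx'))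
  · rintro ⟨r, x, t⟩ hx
    obtain ⟨rfl, hx', rfl⟩ := (hmem0 _).1 hx
    have h1 : B (D x) x = 0 := hB.homogeneous 1 0 (by decide) _ (hD0 x hx') x hx'
    simp [doubleExtension, h1, ha.even_self x hx']
  · rintro ⟨r, x, t⟩ ⟨r', y, t'⟩
    simp only [doubleExtension, Prod.neg_mk, Prod.mk.injEq, neg_zero, and_true]
    constructor
    · rw [CharTwo.neg_eq, hpres, hB.symm]
    · rw [ha.antisymm y x]
      module
  · rintro ⟨r, x, t⟩ ⟨r', y, t'⟩ ⟨r'', z, t''⟩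
    have ez : ∀ u v : V, u - v = u + v := fun u v => by rw [sub_eq_add_neg, hneg]
    simp only [doubleExtension, Prod.mk_add_mk, Prod.mk.injEq, map_add, map_smul, hadd_right,
      ha.bracket_add, ha.bracket_smul, ha.add_bracket, ha.smul_bracket, hsmul_right, zero_smul,
      add_zero, and_true, hsq, smul_zero, ez, hDD, mul_zero]
    constructor
    · rw [hD.map_bracket, hB.add_left, hB.invariant, hcomm x (D y), hB.invariant]
      linear_combination -CharTwo.add_self_eq_zero (B (D y) (a.bracket x z))
    · rw [ha.jacobi x y z, hcomm y (D x), hD.map_bracket, hD.map_bracket, hD.map_bracket]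
      linear_combination (norm := module) -t' • h2 (a.bracket (D x) z) - t'' • h2 (a.bracket (D x) y)
  · rintro ⟨r, x, t⟩ hx
    have hx' := (hmem1 _).1 hx
    refine (hmem0 _).2 ⟨by simp [doubleExtension], ?_, rfl⟩
    simp only [doubleExtension, smul_zero, add_zero]
    exact Submodule.add_mem _ (ha.sq_mem x hx') (Submodule.smul_mem _ _ (hD1 x hx'))
  · rintro c ⟨r, x, t⟩ hx
    have hx' := (hmem1 _).1 hx
    simp only [doubleExtension, Prod.smul_mk, Prod.mk.injEq, Pi.zero_apply, mul_zero, add_zero,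
      smul_zero, true_and, and_true, smul_eq_mul, ha.sq_smul c x hx', map_smul]
    module
  · rintro ⟨r, x, t⟩ hx ⟨r', y, t'⟩ hy
    have hx' := (hmem1 _).1 hx
    have hy' := (hmem1 _).1 hy
    simp only [doubleExtension, Prod.mk_add_mk, Prod.mk.injEq, map_add, Pi.zero_apply, mul_zero,
      add_zero, smul_zero, zero_add, and_true, ha.sq_add x hx' y hy']
    -- On odd elements the cocycle vanishes by parity; this is why an odd centre needs no quadratic
    -- form.
    refine ⟨(hB.homogeneous 0 1 (by decide) _ (hD1 x hx') y hy').symm, ?_⟩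
    linear_combination (norm := module) t' • h2 (D x)
  · rintro ⟨r, x, t⟩ hx ⟨r', y, t'⟩
    have hx' := (hmem1 _).1 hx
    have ez : ∀ u v : V, u - v = u + v := fun u v => by rw [sub_eq_add_neg, hneg]
    simp only [doubleExtension, Prod.mk.injEq, map_add, map_smul, hadd_right,
      ha.bracket_add, ha.bracket_smul, ha.add_bracket, ha.smul_bracket, hsmul_right, zero_smul,
      add_zero, and_true, hsq, smul_zero, ez, hDD, mul_zero]
    constructor
    · rw [hD.map_sq x hx', hB.invariant]
    · rw [ha.sq_bracket x hx', hD.map_bracket, hD.map_sq x hx', hcomm x (D x)]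
      linear_combination (norm := module) -t • h2 (a.bracket x (D y))

theorem isNIS_doubleExtension {a : SuperData K V}
    {B : V → V → K} (hB : IsNIS a B 0) {D : V →ₗ[K] V}
    (hpres : ∀ x y, B (D x) y = B x (D y)) :
    IsNIS (doubleExtension a B 0 D ⟨1, 0, 0, 0, 0⟩) (extensionForm B ⟨1, 0, 0, 0, 0⟩) 0 := by
  have hneg : ∀ x : V, -x = x := self_neg K
  have hadd_right : ∀ x y z, B x (y + z) = B x y + B x z := fun x y z => by
    rw [hB.symm, hB.add_left, hB.symm y, hB.symm z]
  have hsmul_right : ∀ (r : K) x y, B x (r • y) = r * B x y := fun r x y => by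
    rw [hB.symm, hB.smul_left, hB.symm y]
  have hzero : ∀ y, B 0 y = 0 := fun y => by
    have := hB.smul_left 0 0 y
    rwa [zero_smul, zero_mul] at this
  have hmem0 : ∀ x : K × V × K, x ∈ (doubleExtension a B 0 D ⟨1, 0, 0, 0, 0⟩).part 0 ↔
      x.1 = 0 ∧ x.2.1 ∈ a.part 0 ∧ x.2.2 = 0 := by
    intro x
    simp [doubleExtension, Submodule.mem_prod]
  have hmem1 : ∀ x : K × V × K, x ∈ (doubleExtension a B 0 D ⟨1, 0, 0, 0, 0⟩).part 1 ↔
      x.2.1 ∈ a.part 1 := by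
    intro x
    simp [doubleExtension, Submodule.mem_prod]
  have ez : ∀ u v : V, u - v = u + v := fun u v => by rw [sub_eq_add_neg, hneg]
  refine
    { add_left := ?_, smul_left := ?_, symm := ?_, odd_self := ?_, invariant := ?_,
      nondegenerate := ?_, homogeneous := ?_ }
  · rintro ⟨r, x, t⟩ ⟨r', y, t'⟩ ⟨r'', z, t''⟩
    simp only [extensionForm, Prod.mk_add_mk, hB.add_left]
    ring
  · rintro c ⟨r, x, t⟩ ⟨r', y, t'⟩
    simp only [extensionForm, Prod.smul_mk, hB.smul_left, smul_eq_mul]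
    ring
  · rintro ⟨r, x, t⟩ ⟨r', y, t'⟩
    simp only [extensionForm]
    rw [hB.symm]
    ring
  · rintro ⟨r, x, t⟩ hx
    simp only [extensionForm, hB.odd_self x ((hmem1 _).1 hx)]
    linear_combination CharTwo.add_self_eq_zero (r * t)
  · rintro ⟨r, x, t⟩ ⟨r', y, t'⟩ ⟨r'', z, t''⟩
    simp only [extensionForm, doubleExtension, ez, hB.add_left, hB.smul_left, hadd_right,
      hsmul_right, hB.invariant, hpres]
    ring
  · rintro ⟨r, x, t⟩ h
    have ht := h (1, 0, 0)
    have hr := h (0, 0, 1)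
    have hx : x = 0 := hB.nondegenerate x fun y => by
      simpa [extensionForm] using h (0, y, 0)
    simp only [extensionForm, hx, hzero] at ht hr
    rw [hx, show r = 0 by simpa using hr, show t = 0 by simpa using ht]
    rfl
  · rintro i j hij ⟨r, x, t⟩ hx ⟨r', y, t'⟩ hy
    have hcases : ∀ i : ZMod 2, i = 0 ∨ i = 1 := by decide
    rcases hcases i with rfl | rfl <;> rcases hcases j with rfl | rfl
    · exact absurd rfl hij
    · obtain ⟨rfl, hx', rfl⟩ := (hmem0 _).1 hx
      simpa [extensionForm] using hB.homogeneous 0 1 hij x hx' y ((hmem1 _).1 hy)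
    · obtain ⟨rfl, hy', rfl⟩ := (hmem0 _).1 hy
      simpa [extensionForm] using hB.homogeneous 1 0 hij x ((hmem1 _).1 hx) y hy'
    · exact absurd (CharTwo.add_self_eq_zero _) hij

end DoubleExtension
-- Classification of data and identification with the Buttin superalgebra
section Extensions

variable {K : Type*} [Field K] {N : ℕ}

lemma bracket_empty_apply (f g : Fn K N) :
    (buttin K N).bracket f g ∅ = ∑ v : Var N, f {v} * g {v.swap} := by
  rw [bracket_eq_sum, Finset.sum_apply]
  refine Finset.sum_congr rfl fun v _ => ?_
  simp [mul, pd]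

lemma bracket_mono_empty (f : Fn K N) : (buttin K N).bracket (mono K N ∅) f = 0 := by
  rw [bracket_eq_sum]
  refine Finset.sum_eq_zero fun v _ => ?_
  rw [pd_mono, if_neg (Finset.notMem_empty v), zero_mul']

lemma sq_mono_empty : (buttin K N).sq (mono K N ∅) = 0 := by
  change ∑ i : Fin N, _ = (0 : Fn K N)
  refine Finset.sum_eq_zero fun i _ => ?_
  rw [pd_mono, if_neg (Finset.notMem_empty _), zero_mul']

lemma sq_mono_univ (hN : 2 ≤ N) : (buttin K N).sq (mono K N Finset.univ) = 0 := by
  change ∑ i : Fin N, _ = (0 : Fn K N)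
  refine Finset.sum_eq_zero fun i _ => ?_
  obtain ⟨j, hj⟩ : ∃ j : Fin N, j ≠ i := by
    have : Nontrivial (Fin N) := Fin.nontrivial_iff_two_le.2 hN
    exact exists_ne i
  rw [pd_mono, pd_mono, if_pos (Finset.mem_univ _), if_pos (Finset.mem_univ _)]
  funext S
  rw [mono_mul]
  split_ifs with h
  · apply mono_apply_ne
    intro he
    have h1 : Sum.inl j ∈ S := h (by simp [hj])
    have := Finset.ext_iff.1 he (Sum.inl j)
    simp [hj] at this
  · rfl

lemma trunc_eq_self {f : Fn K N} (h : f ∅ = 0) : trunc f = f := by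
  funext S
  rw [trunc_apply]
  split_ifs with hS
  · rw [hS, h]
  · rfl

variable [CharP K 2]

lemma leOneForm_derivB (hN : 2 ≤ N) (b : Var N) (x y : LeOneSpace K N) :
    leOneForm K N (derivB K N b x) y = leOneForm K N x (derivB K N b y) := by
  rw [leOneForm_eq, leOneForm_eq, repOne_derivB, repOne_derivB,
    buttinForm_trunc (repOne_univ hN y), buttinForm_symm _ (trunc _),
    buttinForm_trunc (repOne_univ hN x), buttinForm_symm _ (repOne x)]
  simp only [buttinForm]
  rw [mul_comm' (mono K N {b}), mul_assoc', berezin_pd_mul, pd_mul, pd_mono,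
    if_neg (by simpa using swap_ne b), zero_mul', zero_add]

/-- The cocycle of the top derivation is the constant term lost in passing to the quotient by
constants; invariance moves X̄ out of the bracket. -/
lemma leOneForm_derivTop_left (hN : 2 ≤ N) (x y : LeOneSpace K N) :
    leOneForm K N (derivTop K N x) y = (buttin K N).bracket (repOne x) (repOne y) ∅ := by
  rw [leOneForm_eq, repOne_derivTop, buttinForm_trunc (repOne_univ hN y), buttinForm_invariant,
    buttinForm_mono, Finset.compl_univ]

lemma leOneForm_derivTop (hN : 2 ≤ N) (x y : LeOneSpace K N) :
    leOneForm K N (derivTop K N x) y = leOneForm K N x (derivTop K N y) := by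
  rw [(isNIS_leOne hN).symm x, leOneForm_derivTop_left hN, leOneForm_derivTop_left hN,
    bracket_comm]

omit [CharP K 2] in
lemma derivB_derivB (b : Var N) (x : LeOneSpace K N) : derivB K N b (derivB K N b x) = 0 := by
  apply repOne_injective
  rw [repOne_derivB, repOne_derivB, pd_trunc, map_zero]
  have : mul (mono K N {b}) (pd b.swap (mul (mono K N {b}) (pd b.swap (repOne x)))) = 0 := by
    funext S
    simp [mono_mul, pd, swap_ne b]
  rw [this, map_zero]

lemma derivTop_derivTop (hN : 2 ≤ N) (x : LeOneSpace K N) :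
    derivTop K N (derivTop K N x) = 0 := by
  apply repOne_injective
  have h0 : (buttin K N).bracket 0 (repOne x) = 0 := by
    have := bracket_smul_left 0 0 (repOne x)
    rwa [zero_smul, zero_smul] at this
  rw [repOne_derivTop, repOne_derivTop, bracket_trunc_right, ← sq_bracket', sq_mono_univ hN, h0,
    map_zero, map_zero]

/-- The centre of `𝔩𝔢⁽¹⁾(N|N)` is trivial. -/
lemma eq_zero_of_bracket_eq_zero (hN : 2 ≤ N) {x : LeOneSpace K N}
    (hx : ∀ y, (leOne K N).bracket x y = 0) : x = 0 := by
  apply repOne_injective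
  rw [map_zero]
  funext S
  rw [Pi.zero_apply]
  rcases S.eq_empty_or_nonempty with rfl | ⟨a, ha⟩
  · exact repOne_empty x
  obtain ⟨T, haT, rfl⟩ : ∃ T, a ∉ T ∧ insert a T = S :=
    ⟨S.erase a, Finset.notMem_erase a S, Finset.insert_erase ha⟩
  by_cases hT : T = ∅
  · subst hT
    rw [insert_empty_eq]
    -- The bracket with S(a) would show a linear coefficient only as a constant, which is zero in
    -- the quotient. The bracket with S(a)w shows it as the coefficient of w, and N ≥ 2 provides
    -- such a w.
    obtain ⟨w, hwa, hwb⟩ : ∃ w : Var N, w ≠ a ∧ w ≠ a.swap := by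
      have : Nontrivial (Fin N) := Fin.nontrivial_iff_two_le.2 hN
      rcases a with i | i <;> obtain ⟨j, hj⟩ := exists_ne i <;>
        exact ⟨Sum.inl j, by simp [hj], by simp [hj]⟩
    have hS : ({a.swap, w} : Finset (Var N)) ≠ Finset.univ := by
      intro h
      have := Finset.ext_iff.1 h a
      simp [Ne.symm hwa, (swap_ne a).symm] at this
    have hmul : mono K N {a.swap, w} = mul (mono K N {a.swap}) (mono K N {w}) := by
      funext U
      rw [mono_mul]
      by_cases hU : a.swap ∈ U
      · rw [if_pos (by simpa using hU)]
        simp only [mono, Pi.single_apply]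
        congr 1
        apply propext
        rw [Finset.sdiff_singleton_eq_erase]
        constructor
        · rintro rfl
          rw [Finset.erase_insert]
          simpa using Ne.symm hwb
        · intro h
          rw [← h, Finset.insert_erase hU]
      · rw [if_neg (by simpa using hU), mono_apply_ne]
        rintro rfl
        simp at hU
    have h := congrArg (fun u => repOne u {w}) (hx (monoOne K {a.swap, w} hS))
    simp only [map_zero, Pi.zero_apply] at h
    rw [repOne_bracket, repOne_monoOne _ (Finset.insert_ne_empty _ _), bracket_comm, hmul,
      bracket_mul_left, bracket_mono_singleton, bracket_mono_singleton, Sum.swap_swap,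
      trunc_apply, if_neg (Finset.singleton_ne_empty w), Pi.add_apply, mono_mul, mono_mul,
      if_pos subset_rfl, if_neg, add_zero, Finset.sdiff_self] at h
    · simpa [pd] using h
    · simpa using Ne.symm hwb
  · have h := congrArg (fun u => repOne u T) (hx (monoOne K {a.swap} (singleton_ne_univ _)))
    simp only [map_zero, Pi.zero_apply] at h
    rwa [repOne_bracket_singleton x _ hT (by rwa [Sum.swap_swap]), Sum.swap_swap] at h

omit [CharP K 2] in
lemma parity_of_isOddCentredDatum {p : ZMod 2} {D : LeOneSpace K N →ₗ[K] LeOneSpace K N}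
    {δ : ExtensionDatum K (LeOneSpace K N)}
    (h : IsOddCentredDatum (leOne K N) (leOneForm K N) p D δ) : p + δ.parity = 1 := by
  by_contra hne
  have := h.2
  simp [doubleExtension, Submodule.mem_prod, Ne.symm hne] at this

/-- An operator of the appropriate parity that preserves the form and, if odd, has square zero
defines precisely one double extension with odd centre. -/
theorem isOddCentredDatum_iff (hN : 2 ≤ N) {D : LeOneSpace K N →ₗ[K] LeOneSpace K N}
    {p : ZMod 2} (hp : (N : ZMod 2) + p = 1) (hder : IsDerivation (leOne K N) D p)
    (hpres : ∀ x y, leOneForm K N (D x) y = leOneForm K N x (D y))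
    (hsq : ∀ x, D (D x) = 0) (δ : ExtensionDatum K (LeOneSpace K N)) :
    IsOddCentredDatum (leOne K N) (leOneForm K N) (N : ZMod 2) D δ ↔ δ = ⟨p, 0, 0, 0, 0⟩ := by
  have hz : ∀ x, (leOne K N).bracket 0 x = 0 := fun x => by
    have := (isLieSuperalgebra_leOne (K := K) hN).smul_bracket 0 0 x
    rwa [zero_smul, zero_smul] at this
  constructor
  · intro h
    have hparity := parity_of_isOddCentredDatum h
    obtain ⟨p', q, A, m, e⟩ := δ
    obtain rfl : p' = p := by
      have : (N : ZMod 2) + p' = N + p := hparity.trans hp.symm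
      exact add_left_cancel this
    obtain ⟨h, -⟩ := h
    have hq : q = 0 := h.q_eq_zero (by rw [hparity]; exact one_ne_zero)
    have hm : m = 0 := h.m_eq_zero (by
      rintro ⟨h1, h2⟩
      rw [h1, h2] at hparity
      exact absurd hparity (by decide))
    have he : e = 0 := h.e_eq_zero (by
      rintro ⟨h1, h2⟩
      rw [h1, h2] at hparity
      exact absurd hparity (by decide))
    have hA : A = 0 := by
      by_cases h1 : p' = 1
      · refine eq_zero_of_bracket_eq_zero hN fun y => ?_
        have := h.D_sq h1 y
        rwa [hsq, eq_comm] at this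
      · exact h.A_eq_zero h1
    rw [hq, hm, he, hA]
  · rintro rfl
    have hp0 : (N : ZMod 2) + p ≠ 0 := by rw [hp]; exact one_ne_zero
    refine ⟨?_, by simp [doubleExtension, Submodule.mem_prod, hp]⟩
    refine
      { derivation := hder, preserves := ⟨fun x y => ?_, fun f hf => ?_⟩,
        q_smul := fun h => absurd h hp0, q_polar := fun h => absurd h hp0,
        q_eq_zero := fun _ => rfl, A_mem := Submodule.zero_mem _,
        D_sq := fun _ x => by rw [hsq, hz], D_A := fun _ => map_zero D,
        A_eq_zero := fun _ => rfl, m_eq_zero := fun _ => rfl, e_eq_zero := fun _ => rfl }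
    · rw [hpres]
      exact CharTwo.add_self_eq_zero _
    -- The total parity of (Df, f) is p, and the form has parity N = p + 1.
    · refine (isNIS_leOne hN).homogeneous (1 + p) 1 ?_ _ (hder.map_part 1 f hf) f hf
      rw [← sub_eq_of_eq_add' hp.symm]
      generalize (N : ZMod 2) = M
      revert M
      decide

lemma repOne_derivTop' (x : LeOneSpace K N) :
    repOne (derivTop K N x) = (buttin K N).bracket (mono K N Finset.univ) (repOne x) := by
  rw [repOne_derivTop, trunc_eq_self]
  rw [bracket_empty_apply]
  refine Finset.sum_eq_zero fun v _ => ?_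
  rw [mono_apply_ne (singleton_ne_univ v), zero_mul]

omit [CharP K 2] in
lemma univ_ne_empty (hN : 2 ≤ N) : (Finset.univ : Finset (Var N)) ≠ ∅ := by
  have : Nonempty (Var N) := ⟨Sum.inl ⟨0, by omega⟩⟩
  exact Finset.univ_nonempty.ne_empty

variable (K N) in
/-- The map sending `r c + x + t D` to the sum of the constant `r`, the constant-free
representative of `x`, and the multiple by `t` of the product of all indeterminates. -/
def assemble : K × LeOneSpace K N × K →ₗ[K] Fn K N :=
  (LinearMap.toSpanSingleton K _ (mono K N ∅)).coprod
    (repOne.coprod (LinearMap.toSpanSingleton K _ (mono K N Finset.univ)))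

omit [CharP K 2] in
lemma assemble_apply (r : K) (x : LeOneSpace K N) (t : K) :
    assemble K N (r, x, t) = r • mono K N ∅ + (repOne x + t • mono K N Finset.univ) := rfl

omit [CharP K 2] in
lemma assemble_empty (hN : 2 ≤ N) (r : K) (x : LeOneSpace K N) (t : K) :
    assemble K N (r, x, t) ∅ = r := by
  simp [assemble_apply, mono_apply_self, mono_apply_ne (univ_ne_empty hN).symm]

lemma assemble_univ (hN : 2 ≤ N) (r : K) (x : LeOneSpace K N) (t : K) :
    assemble K N (r, x, t) Finset.univ = t := by
  simp [assemble_apply, mono_apply_self, mono_apply_ne (univ_ne_empty hN), repOne_univ hN]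

lemma assemble_bijective (hN : 2 ≤ N) : Function.Bijective (assemble K N) := by
  constructor
  · rw [← LinearMap.ker_eq_bot, LinearMap.ker_eq_bot']
    rintro ⟨r, x, t⟩ h
    have hr := congrFun h ∅
    have ht := congrFun h Finset.univ
    rw [assemble_empty hN] at hr
    rw [assemble_univ hN] at ht
    simp only [Pi.zero_apply] at hr ht
    subst hr ht
    have hx : x = 0 := repOne_injective (by simpa [assemble_apply] using h)
    rw [hx]
    rfl
  · intro f
    refine ⟨(f ∅, ofFn (f - f Finset.univ • mono K N Finset.univ) (by
      simp [mono_apply_self]), f Finset.univ), ?_⟩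
    funext S
    by_cases h0 : S = ∅
    · rw [h0, assemble_empty hN]
    · rw [assemble_apply]
      simp [trunc_apply, h0, mono_apply_ne h0]

/-- The double extension of `𝔩𝔢⁽¹⁾(N|N)` by the derivation of degree `2N - 2` is the Buttin
superalgebra. -/
theorem nisIsomorphic_derivTop (hN : 2 ≤ N) {p : ZMod 2} (hp : p = (N : ZMod 2) + 1) :
    NisIsomorphic
      (doubleExtension (leOne K N) (leOneForm K N) (N : ZMod 2) (derivTop K N) ⟨p, 0, 0, 0, 0⟩)
      (extensionForm (leOneForm K N) ⟨p, 0, 0, 0, 0⟩) (buttin K N) (buttinForm K N) := by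
  have hNp : (N : ZMod 2) + p = 1 := by
    rw [hp]
    linear_combination (N : ZMod 2) * CharTwo.two_eq_zero (R := ZMod 2)
  have hpart : ∀ i (x : K × LeOneSpace K N × K), x ∈ (doubleExtension (leOne K N) (leOneForm K N)
      (N : ZMod 2) (derivTop K N) ⟨p, 0, 0, 0, 0⟩).part i ↔
        (1 ≠ i → x.1 = 0) ∧ x.2.1 ∈ (leOne K N).part i ∧ ((N : ZMod 2) + 1 ≠ i → x.2.2 = 0) := by
    intro i x
    simp only [doubleExtension, Submodule.mem_prod, hNp, ← hp]
    have h : ∀ (q : ZMod 2) (r : K), (r ∈ (if i = q then ⊤ else ⊥ : Submodule K K)) ↔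
        (q ≠ i → r = 0) := by
      intro q r
      by_cases hi : i = q
      · simp [hi]
      · simp [hi, Ne.symm hi]
    rw [h, h]
  refine ⟨LinearEquiv.ofBijective (assemble K N) (assemble_bijective hN), ?_, ?_, ?_, ?_⟩
  · rintro i ⟨r, x, t⟩
    rw [hpart, LinearEquiv.ofBijective_apply]
    have he := mono_mem_part (K := K) (∅ : Finset (Var N))
    have hu := mono_mem_part (K := K) (Finset.univ : Finset (Var N))
    rw [show degPi (∅ : Finset (Var N)) = 0 from rfl, Nat.cast_zero, zero_add] at he
    rw [degPi_univ] at hu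
    constructor
    · rintro ⟨h1, h2, h3⟩
      rw [assemble_apply]
      refine Submodule.add_mem _ ?_ (Submodule.add_mem _ (mem_leOne_part.1 h2) ?_)
      · by_cases h : 1 = i
        · exact Submodule.smul_mem _ _ (h ▸ he)
        · rw [show r = 0 from h1 h, zero_smul]; exact Submodule.zero_mem _
      · by_cases h : (N : ZMod 2) + 1 = i
        · exact Submodule.smul_mem _ _ (h ▸ hu)
        · rw [show t = 0 from h3 h, zero_smul]; exact Submodule.zero_mem _
    · intro h
      refine ⟨fun h1 => ?_, mem_leOne_part.2 fun S hS => h S ?_, fun h1 => ?_⟩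
      · by_contra hr
        exact h1 (by simpa [degPi] using h ∅ (by rwa [assemble_empty hN]))
      · have hS0 : S ≠ ∅ := by rintro rfl; exact hS (repOne_empty x)
        have hSu : S ≠ Finset.univ := by rintro rfl; exact hS (repOne_univ hN x)
        simpa [assemble_apply, mono_apply_ne hS0, mono_apply_ne hSu] using hS
      · by_contra ht
        have := h Finset.univ (by rwa [assemble_univ hN])
        rw [degPi_univ] at this
        exact h1 this
  · rintro ⟨r, x, t⟩ ⟨r', y, t'⟩
    simp only [LinearEquiv.ofBijective_apply, doubleExtension]
    have hconst : ∀ f : Fn K N, f ∅ • mono K N ∅ + trunc f = f := by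
      intro f
      funext S
      by_cases h : S = ∅
      · simp [h, mono_apply_self, trunc_apply]
      · simp [h, mono_apply_ne h, trunc_apply]
    rw [assemble_apply, assemble_apply, assemble_apply, leOneForm_derivTop_left hN, map_sub,
      map_add, map_smul, map_smul, repOne_derivTop', repOne_derivTop', repOne_bracket,
      zero_smul, add_zero, sub_eq_add_neg, neg_eq', ← add_assoc, ← add_assoc, hconst]
    have hempty : ∀ f : Fn K N, (buttin K N).bracket f (mono K N ∅) = 0 := fun f => by
      rw [bracket_comm, bracket_mono_empty]
    simp only [bracket_add_left, bracket_add_right, bracket_smul_left, bracket_smul_right,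
      bracket_mono_empty, hempty, bracket_self', smul_zero, zero_add, add_zero]
    rw [bracket_comm (repOne x) (mono K N Finset.univ)]
  · rintro ⟨r, x, t⟩ hf
    have hx := ((hpart _ _).1 hf).2.1
    -- Squares are even while the constant 1 is odd, so no c-component is lost by truncation.
    have h0 : (buttin K N).sq (repOne x) ∅ = 0 := by
      by_contra h
      have := sq_mem_part (mem_leOne_part.1 hx) ∅ h
      simp [degPi] at this
    simp only [LinearEquiv.ofBijective_apply, doubleExtension]
    rw [assemble_apply, assemble_apply, map_add, map_add, map_smul, repOne_sq hx,
      trunc_eq_self h0, repOne_derivTop', sq_add', sq_add', sq_smul', sq_smul', sq_mono_empty,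
      sq_mono_univ hN, bracket_smul_left, bracket_mono_empty, bracket_smul_right,
      bracket_comm _ (mono K N Finset.univ)]
    simp
  · rintro ⟨r, x, t⟩ ⟨r', y, t'⟩
    simp only [LinearEquiv.ofBijective_apply, extensionForm, leOneForm_eq]
    have hright : ∀ f g h : Fn K N,
        buttinForm K N f (g + h) = buttinForm K N f g + buttinForm K N f h := fun f g h => by
      rw [buttinForm_symm, buttinForm_add_left, buttinForm_symm g, buttinForm_symm h]
    rw [assemble_apply, assemble_apply, buttinForm_add_left, buttinForm_add_left,
      buttinForm_smul_left, buttinForm_smul_left, buttinForm_mono, buttinForm_mono,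
      hright, hright, buttinForm_symm (repOne x) (r' • _), buttinForm_symm (repOne x) (t' • _),
      buttinForm_smul_left, buttinForm_smul_left, buttinForm_mono, buttinForm_mono]
    simp [mono_apply_self, mono_apply_ne (univ_ne_empty hN),
      mono_apply_ne (univ_ne_empty hN).symm, repOne_univ hN]
    ring

omit [CharP K 2] in
lemma derivB_ne_zero (b : Var N) : derivB K N b (monoOne K {b.swap} (singleton_ne_univ _)) ≠ 0 := by
  intro h
  have h' := congrArg (fun x => repOne x {b}) h
  simp only [repOne_derivB_singleton, mono_apply_self, map_zero, Pi.zero_apply] at h'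
  exact one_ne_zero h'

omit [CharP K 2] in
lemma eq_zero_of_mem_both {x : LeOneSpace K N} {i j : ZMod 2} (hij : i ≠ j)
    (hi : x ∈ (leOne K N).part i) (hj : x ∈ (leOne K N).part j) : x = 0 := by
  apply repOne_injective
  rw [map_zero]
  funext S
  by_contra hS
  exact hij ((mem_leOne_part.1 hi S hS).symm.trans (mem_leOne_part.1 hj S hS))

/-- A nonzero odd operator cannot be even as well. -/
lemma not_isDerivation_derivB_even (b : Var N) :
    ¬ IsDerivation (leOne K N) (derivB K N b) 0 := by
  intro h
  have hm := monoOne_mem_part (K := K) {b.swap} (singleton_ne_univ _)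
  refine derivB_ne_zero (K := K) b (eq_zero_of_mem_both ?_ (h.map_part _ _ hm)
    ((isDerivation_derivB b).map_part _ _ hm))
  intro he
  exact zero_ne_one (add_left_cancel he)

omit [CharP K 2] in
lemma monoOne_inl_mem (i : Fin N) :
    monoOne K {Sum.inl i} (singleton_ne_univ _) ∈ (leOne K N).part 1 := by
  have := monoOne_mem_part (K := K) {Sum.inl i} (singleton_ne_univ _)
  rw [degPi_singleton] at this
  convert this using 2
  simp

lemma not_isDerivation_derivZero_odd (hN : 2 ≤ N) :
    ¬ IsDerivation (leOne K N) (derivZero K N) 1 := by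
  intro h
  have hm := monoOne_inl_mem (K := K) (⟨0, by omega⟩ : Fin N)
  have h' := h.map_part _ _ hm
  rw [derivZero_of_odd hN hm] at h'
  have h0 := eq_zero_of_mem_both (by decide) hm h'
  have := congrArg (fun x => repOne x {Sum.inl ⟨0, by omega⟩}) h0
  rw [repOne_monoOne _ (Finset.singleton_ne_empty _)] at this
  simp [mono_apply_self] at this

lemma not_preserves_derivZero (hN : 2 ≤ N) (hodd : (N : ZMod 2) = 1) :
    ¬ Preserves (leOne K N) (leOneForm K N) (derivZero K N) := by
  intro h
  let v : Var N := Sum.inl ⟨0, by omega⟩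
  have hm : monoOne K {v} (singleton_ne_univ _) ∈ (leOne K N).part 1 := monoOne_inl_mem _
  have hu : Finset.univ.erase v ≠ Finset.univ := by
    intro h
    have := Finset.ext_iff.1 h v
    simp at this
  have he : (Finset.univ : Finset (Var N)).erase v ≠ ∅ := by
    intro h
    have := Finset.ext_iff.1 h v.swap
    simp [v] at this
  -- For odd N the complement of q_0 is even. It pairs to 1 with the odd q_0, but D_0 fixes q_0 and
  -- kills the complement.
  have hm' : monoOne K (Finset.univ.erase v) hu ∈ (leOne K N).part 0 := by
    have h1 := monoOne_mem_part (K := K) (Finset.univ.erase v) hu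
    have h2 := degPi_insert (Finset.notMem_erase v Finset.univ)
    rw [Finset.insert_erase (Finset.mem_univ v), degPi_univ] at h2
    have h3 : degPi (Finset.univ.erase v) = N := by simpa [v] using h2.symm
    rw [h3, hodd] at h1
    exact h1
  have h1 := h.1 (monoOne K {v} (singleton_ne_univ _)) (monoOne K (Finset.univ.erase v) hu)
  rw [derivZero_of_odd hN hm, derivZero_of_even hN hm', leOneForm_eq, leOneForm_eq,
    repOne_monoOne _ (Finset.singleton_ne_empty _), repOne_monoOne _ he, map_zero,
    buttinForm_mono, buttinForm_mono] at h1
  have : ({v}ᶜ : Finset (Var N)) = Finset.univ.erase v := by ext; simp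
  rw [this, mono_apply_self, Pi.zero_apply, add_zero] at h1
  exact one_ne_zero h1

end Extensions

end Buttin

/-! ### The main theorem -/

open Buttin in
theorem mainTheorem8 (K : Type*) [Field K] [IsAlgClosed K] [CharP K 2] :
    (∀ N : ℕ, 2 ≤ N →
      IsLieSuperalgebra (leOne K N) ∧
      IsNIS (leOne K N) (leOneForm K N) (N : ZMod 2) ∧
      (∀ b : Var N, IsOuterDerivation (leOne K N) (derivB K N b) 1) ∧
      IsOuterDerivation (leOne K N) (derivZero K N) 0 ∧
      IsOuterDerivation (leOne K N) (derivTop K N) ((N : ZMod 2) + 1) ∧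
      ∀ (D : LeOneSpace K N →ₗ[K] LeOneSpace K N) (δ : ExtensionDatum K (LeOneSpace K N)),
        IsOddCentredDatum (leOne K N) (leOneForm K N) (N : ZMod 2) D δ →
          (Even N → δ.parity = 1) ∧ (Odd N → δ.parity = 0)) ∧
    (∀ n N : ℕ, 1 ≤ n → N = 2 * n →
      (∀ b : Var N,
        (∀ δ, IsOddCentredDatum (leOne K N) (leOneForm K N) (N : ZMod 2) (derivB K N b) δ ↔
          δ = oddDatum K N) ∧
        IsLieSuperalgebra (tildeButtin K N b) ∧
        IsNIS (tildeButtin K N b) (extensionForm (leOneForm K N) (oddDatum K N)) 0) ∧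
      (¬ ∃ δ, IsOddCentredDatum (leOne K N) (leOneForm K N) (N : ZMod 2) (derivZero K N) δ) ∧
      (∀ δ, IsOddCentredDatum (leOne K N) (leOneForm K N) (N : ZMod 2) (derivTop K N) δ ↔
        δ = oddDatum K N) ∧
      IsLieSuperalgebra (buttin K N) ∧
      IsNIS (buttin K N) (buttinForm K N) 0 ∧
      NisIsomorphic
        (doubleExtension (leOne K N) (leOneForm K N) (N : ZMod 2) (derivTop K N) (oddDatum K N))
        (extensionForm (leOneForm K N) (oddDatum K N)) (buttin K N) (buttinForm K N)) ∧
    (∀ n N : ℕ, 1 ≤ n → N = 2 * n + 1 →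
      (∀ b : Var N,
        ¬ ∃ δ, IsOddCentredDatum (leOne K N) (leOneForm K N) (N : ZMod 2) (derivB K N b) δ) ∧
      (¬ ∃ δ, IsOddCentredDatum (leOne K N) (leOneForm K N) (N : ZMod 2) (derivZero K N) δ) ∧
      (∀ δ, IsOddCentredDatum (leOne K N) (leOneForm K N) (N : ZMod 2) (derivTop K N) δ ↔
        δ = evenDatum K N) ∧
      IsLieSuperalgebra (buttin K N) ∧
      IsNIS (buttin K N) (buttinForm K N) 1 ∧
      NisIsomorphic
        (doubleExtension (leOne K N) (leOneForm K N) (N : ZMod 2) (derivTop K N) (evenDatum K N))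
        (extensionForm (leOneForm K N) (evenDatum K N)) (buttin K N) (buttinForm K N)) := by
  refine ⟨fun N hN => ⟨isLieSuperalgebra_leOne hN, isNIS_leOne hN, isOuterDerivation_derivB,
    isOuterDerivation_derivZero hN, isOuterDerivation_derivTop hN, fun D δ h => ?_⟩, ?_, ?_⟩
  · have hp := parity_of_isOddCentredDatum h
    refine ⟨fun he => ?_, fun ho => ?_⟩
    · rwa [(ZMod.natCast_eq_zero_iff_even).2 he, zero_add] at hp
    · rwa [(ZMod.natCast_eq_one_iff_odd).2 ho, add_eq_left] at hp
  · intro n N hn hNn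
    have hN : 2 ≤ N := by omega
    have h0 : (N : ZMod 2) = 0 := (ZMod.natCast_eq_zero_iff_even).2 ⟨n, by omega⟩
    have hpar : (N : ZMod 2) + 1 = 1 := by rw [h0, zero_add]
    have hNIS := isNIS_leOne (K := K) hN
    have hbut := isNIS_buttin (K := K) (N := N) (by omega)
    rw [h0] at hNIS hbut
    refine ⟨fun b => ⟨isOddCentredDatum_iff hN hpar (isDerivation_derivB b)
      (leOneForm_derivB hN b) (derivB_derivB b), ?_, ?_⟩, ?_, ?_, isLieSuperalgebra_buttin, hbut,
      nisIsomorphic_derivTop hN hpar.symm⟩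
    · rw [tildeButtin, h0]
      exact isLieSuperalgebra_doubleExtension (isLieSuperalgebra_leOne hN) hNIS
        (isDerivation_derivB b) (leOneForm_derivB hN b) (derivB_derivB b)
    · rw [tildeButtin, h0]
      exact isNIS_doubleExtension hNIS (leOneForm_derivB hN b)
    · rintro ⟨δ, h⟩
      have hp := parity_of_isOddCentredDatum h
      rw [h0, zero_add] at hp
      have hd := h.1.derivation
      rw [hp] at hd
      exact not_isDerivation_derivZero_odd hN hd
    · have hd := isDerivation_derivTop (K := K) (N := N)
      rw [hpar] at hd
      exact isOddCentredDatum_iff hN hpar hd (leOneForm_derivTop hN) (derivTop_derivTop hN)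
  · intro n N hn hNn
    have hN : 2 ≤ N := by omega
    have h1 : (N : ZMod 2) = 1 := (ZMod.natCast_eq_one_iff_odd).2 ⟨n, by omega⟩
    have hpar : (N : ZMod 2) + 1 = 0 := by rw [h1]; decide
    have hbut := isNIS_buttin (K := K) (N := N) (by omega)
    rw [h1] at hbut
    refine ⟨fun b => ?_, ?_, ?_, isLieSuperalgebra_buttin, hbut,
      nisIsomorphic_derivTop hN hpar.symm⟩
    · rintro ⟨δ, h⟩
      have hp := parity_of_isOddCentredDatum h
      rw [h1, add_eq_left] at hp
      have hd := h.1.derivation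
      rw [hp] at hd
      exact not_isDerivation_derivB_even b hd
    · rintro ⟨δ, h⟩
      exact not_preserves_derivZero hN h1 h.1.preserves
    · have hd := isDerivation_derivTop (K := K) (N := N)
      rw [hpar] at hd
      exact isOddCentredDatum_iff hN (by rw [h1, add_zero]) hd (leOneForm_derivTop hN)
        (derivTop_derivTop hN)
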